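/- Let $(\Omega,\mathcal A,\mathbb P)$ be a probability space and let $\theta:\Omega\to\Omega$ be a bijective bi-measurable map preserving $\mathbb P$. Let $\mathcal F_0\subseteq\mathcal A$ be a $\sigma$-algebra with $\mathcal F_0\subseteq\theta^{-1}(\mathcal F_0)$, let $X_0$ be an $\mathcal F_0$-measurable real random variable with distribution function $F$, and put $X_i=X_0\circ\theta^i$ for $i\ge 0$. Let $\mu$ be a $\sigma$-finite Borel measure on $\mathbb R$ such that $$\int_{\mathbb R_-}F(t)^2\,\mu(dt)+\int_{\mathbb R_+}(1-F(t))^2\,\mu(dt)<\infty .$$ Define $F_n(t)=\frac1n\sum_{i=1}^n\mathbf 1_{X_i\le t}$ and $D_n(\mu)=\bigl(\int (F_n(t)-F(t))^2\,\mu(dt)\bigr)^{1/2}$ for $n\ge1$. Define $F_\mu(x)=\mu([0,x))$ for $x\ge0$ and $F_\mu(x)=-\mu([x,0))$ for $x\le0$ (values $\pm\infty$ are allowed). For a real random variable $X$ and a $\sigma$-algebra $\mathcal F\subseteq\mathcal A$, let $F_X$ be the distribution function of $X$, let $F_{X|\mathcal F}$ be the distribution function of a regular conditional distribution of $X$ given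 $\mathcal F$, and let $$\tau_{\mu,2,p}(\mathcal F,X)=\Bigl\|\Bigl(\int|F_{X|\mathcal F}(t)-F_X(t)|^2\,\mu(dt)\Bigr)^{1/2}\Bigr\|_{L^p(\mathbb P)}\in[0,\infty].$$ Let $1<p<2$ and assume that $\mathbb E\bigl(|F_\mu(X_0)|^{p/2}\bigr)<\infty$ and $$\sum_{n\ge2}\log n\,\frac{\tau_{\mu,2,p}(\mathcal F_0,X_n)}{n^{1/2}}<\infty .$$ Then, almost surely, $D_n(\mu)<\infty$ for all $n\ge1$ and $n\,D_n(\mu)=o(n^{1/p})$ as $n\to\infty$. -/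

import Mathlib

open MeasureTheory ProbabilityTheory Filter Asymptotics
open scoped ENNReal

noncomputable section

namespace EmpiricalProcess

/-- The stationary sequence `X_i = X_0 ∘ θ^i`, `i = 0, 1, 2, …`. -/
def orbitSeq {Ω : Type*} (θ : Ω → Ω) (X₀ : Ω → ℝ) (i : ℕ) (ω : Ω) : ℝ :=
  X₀ (θ^[i] ω)

/-- The distribution function `F_X(t) = P(X ≤ t)` of a real random variable `X`. -/
def distFun {Ω : Type*} [MeasurableSpace Ω] (P : Measure Ω) (X : Ω → ℝ) (t : ℝ) : ℝ :=
  cdf (P.map X) t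

/-- A regular conditional distribution `P_{X|𝓕}` of the real random variable `X` given the
sub-σ-algebra `𝓕`: the conditional distribution of `X` given the identity map, seen as a random
variable with values in the measurable space `(Ω, 𝓕)`. -/
def regCondDistrib {Ω : Type*} (𝓕 : MeasurableSpace Ω) [mΩ : MeasurableSpace Ω]
    (P : Measure Ω) [IsFiniteMeasure P] (X : Ω → ℝ) (ω : Ω) : Measure ℝ :=
  @condDistrib Ω Ω ℝ _ _ _ mΩ 𝓕 X id P _ ω

/-- The conditional distribution function `F_{X|𝓕}(t) = P_{X|𝓕}(]-∞, t])`. -/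
def condDistFun {Ω : Type*} (𝓕 : MeasurableSpace Ω) [MeasurableSpace Ω]
    (P : Measure Ω) [IsFiniteMeasure P] (X : Ω → ℝ) (ω : Ω) (t : ℝ) : ℝ :=
  cdf (regCondDistrib 𝓕 P X ω) t

/-- The dependence coefficient `τ_{μ,2,p}(𝓕, X) = ‖ ‖F_{X|𝓕} - F_X‖_{2,μ} ‖_p`, with values
in `[0, ∞]`. -/
def tau {Ω : Type*} (𝓕 : MeasurableSpace Ω) [MeasurableSpace Ω]
    (P : Measure Ω) [IsFiniteMeasure P] (μ : Measure ℝ) (p : ℝ≥0∞) (X : Ω → ℝ) : ℝ≥0∞ :=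
  eLpNorm (fun ω => eLpNorm (fun t => condDistFun 𝓕 P X ω t - distFun P X t) 2 μ) p P

/-- The function `F_μ(x) = μ([0, x[)` for `x ≥ 0` and `F_μ(x) = -μ([x, 0[)` for `x ≤ 0`.
Since `μ` is only σ-finite, the values are extended real numbers. -/
def signedMass (μ : Measure ℝ) (x : ℝ) : EReal :=
  if 0 ≤ x then (μ (Set.Ico 0 x) : EReal) else -(μ (Set.Ico x 0) : EReal)

/-- The empirical distribution function `F_n(t) = n⁻¹ ∑_{i=1}^n 1_{X_i ≤ t}`. -/
def empDistFun {Ω : Type*} (X : ℕ → Ω → ℝ) (n : ℕ) (ω : Ω) (t : ℝ) : ℝ :=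
  (n : ℝ)⁻¹ * ∑ i ∈ Finset.Icc 1 n, Set.indicator (Set.Iic t) (fun _ => (1 : ℝ)) (X i ω)

/-- The statistic `D_n(μ) = (∫ (F_n(t) - F(t))² μ(dt))^{1/2}`, the `L²(μ)` norm of `F_n - F`, with
values in `[0, ∞]`; here `F` is the distribution function of `X_0`. -/
def cvmStat {Ω : Type*} [MeasurableSpace Ω] (P : Measure Ω) (μ : Measure ℝ)
    (X : ℕ → Ω → ℝ) (n : ℕ) (ω : Ω) : ℝ≥0∞ :=
  eLpNorm (fun t => empDistFun X n ω t - distFun P (X 0) t) 2 μ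

/-- The integrability condition
`∫_{ℝ₋} F(t)² μ(dt) + ∫_{ℝ₊} (1 - F(t))² μ(dt) < ∞`. -/
def TailCondition (μ : Measure ℝ) (F : ℝ → ℝ) : Prop :=
  (∫⁻ t in Set.Iic 0, ENNReal.ofReal (F t ^ 2) ∂μ)
    + (∫⁻ t in Set.Ici 0, ENNReal.ofReal ((1 - F t) ^ 2) ∂μ) < ∞

end EmpiricalProcess

end

/-! Almost surely, `n * D_n(μ)` is the norm in the Hilbert space `L²(μ)` of a Birkhoff sum of `Y`,
where `Y ω` is the function `t ↦ 1_{X₀(ω) ≤ t} - F(t)`. The tail condition and the moment of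
`F_μ(X₀)` put `Y` in `L^p`. Averaging centred indicators against the conditional law of `X_k` bounds
the `L^p` norm `a_k` of `E(Y ∘ θ^k | 𝓕₀)` by the coefficient τ
(`eLpNorm_condExp_centeredStepLp_le_tau`), so `∑ a_k / √k < ∞`. It remains to prove a
Marcinkiewicz-Zygmund law under this projective condition (`tendsto_stationary_sum`).

Put `e_k = E(Y ∘ θ^k | 𝓕₀)`, let `G` be the σ-algebra one step further in the past, and `d_k = e_k -
E(e_k | G)`. By stationarity `E(e_k | G) = e_{k+1} ∘ θ⁻¹`, so `Y` telescopes into `∑ d_k ∘ θ^{-k}`,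
and the Birkhoff sum of `Y` is a series of stationary martingales. The series is controlled because
`L^p` with values in a Hilbert space is 2-uniformly convex: `‖d_k‖_p²` is at most a constant times
`a_k (a_k - a_{k+1})` (`sq_lpNorm_sub_condExp_le`). By Abel summation, `∑ a_k / √k < ∞` then forces
`∑ ‖d_k‖_p < ∞` (`summable_of_sq_le_mul_sub`).

For one stationary martingale, truncation along dyadic blocks bounds the mean of `sup_n n^{-1/p}
‖M_n‖` linearly in `‖d‖_p` (`lintegral_maximalFun_le`), which gives `M_n = o(n^{1/p})`
(`tendsto_martingale`). Linearity lets the maximal functions be summed over `k`, and dominated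
convergence carries the limit through the series. -/

namespace EmpiricalProcess

/-! ### Uniform convexity of `L^p` with values in a Hilbert space, `1 < p < 2` -/

/-- A second order midpoint inequality for a power of a nonnegative quadratic polynomial. -/
theorem rpow_quadratic_midpoint {p A B s ε R : ℝ} (hp1 : 1 < p) (hp2 : p < 2) (hε : 0 < ε)
    (hA : 0 ≤ A) (hB : 0 ≤ B) (hs : s ^ 2 ≤ 4 * A * B)
    (hR : ∀ u ∈ Set.Icc (-1 : ℝ) 1, A + s * u + B * u ^ 2 ≤ R) :
    2 * (ε + A) ^ (p / 2) + p * (p - 1) * B * (ε + R) ^ (p / 2 - 1)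
      ≤ (ε + (A + s + B)) ^ (p / 2) + (ε + (A - s + B)) ^ (p / 2) := by
  set q := p / 2 with hq
  set κ := p * (p - 1) * B * (ε + R) ^ (q - 1) with hκ
  have hnn : ∀ u : ℝ, 0 ≤ A + s * u + B * u ^ 2 := by
    intro u
    rcases hA.eq_or_lt with h0 | hA'
    · have : s = 0 := by
        rw [← h0] at hs
        have := sq_nonneg s
        exact pow_eq_zero_iff (two_ne_zero) |>.1 (by linarith)
      rw [← h0, this]
      nlinarith [mul_nonneg hB (sq_nonneg u)]
    · have h1 : 0 ≤ 4 * A * (A + s * u + B * u ^ 2) := by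
        nlinarith [sq_nonneg (2 * A + s * u), mul_le_mul_of_nonneg_right hs (sq_nonneg u)]
      by_contra hlt
      push Not at hlt
      nlinarith [mul_pos hA' (neg_pos.2 hlt)]
  -- The shift by `ε` keeps the base positive, so that its powers are twice differentiable.
  set Q : ℝ → ℝ := fun u => ε + (A + s * u + B * u ^ 2) with hQ
  have hQpos : ∀ u, 0 < Q u := fun u => by have := hnn u; simp only [hQ]; linarith
  have hQd : ∀ u, HasDerivAt Q (s + 2 * B * u) u := by
    intro u
    have h := ((((hasDerivAt_id u).const_mul s).const_add A).add
      (((hasDerivAt_id u).pow 2).const_mul B)).const_add ε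
    refine h.congr_deriv ?_
    simp; ring
  have hd1 : ∀ u, HasDerivAt (fun u => Q u ^ q - κ / 2 * u ^ 2)
      ((s + 2 * B * u) * q * Q u ^ (q - 1) - κ * u) u := by
    intro u
    have h1 := (hQd u).rpow_const (p := q) (Or.inl (hQpos u).ne')
    have h2 := ((hasDerivAt_id u).pow 2).const_mul (κ / 2)
    refine (h1.sub h2).congr_deriv ?_
    simp; ring
  have hd2 : ∀ u, HasDerivAt (fun u => (s + 2 * B * u) * q * Q u ^ (q - 1) - κ * u)
      (2 * B * q * Q u ^ (q - 1)
        + (s + 2 * B * u) * q * ((s + 2 * B * u) * (q - 1) * Q u ^ (q - 2)) - κ) u := by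
    intro u
    have h1 := (hQd u).rpow_const (p := q - 1) (Or.inl (hQpos u).ne')
    have h0 : HasDerivAt (fun u => (s + 2 * B * u) * q) (2 * B * q) u := by
      have := (((hasDerivAt_id u).const_mul (2 * B)).const_add s).mul_const q
      refine this.congr_deriv ?_
      simp
    have h2 := (hasDerivAt_id u).const_mul κ
    refine ((h0.mul h1).sub h2).congr_deriv ?_
    rw [show q - 1 - 1 = q - 2 by ring]
    simp
  -- The discriminant condition gives `Q'² ≤ 4BQ`. Hence `(Q^q)'' ≥ 2Bq(2q - 1) Q^(q-1) = p(p-1) B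
  -- Q^(q-1)`, which is at least `κ` since `Q ≤ ε + R` and `q < 1`. The claim is convexity between
  -- `-1`, `0` and `1`.
  have hconv : ConvexOn ℝ (Set.Icc (-1 : ℝ) 1) (fun u => Q u ^ q - κ / 2 * u ^ 2) := by
    refine convexOn_of_hasDerivWithinAt2_nonneg (convex_Icc _ _)
      (fun u _ => (hd1 u).continuousAt.continuousWithinAt)
      (fun u _ => (hd1 u).hasDerivWithinAt) (fun u _ => (hd2 u).hasDerivWithinAt) ?_
    intro u hu
    have hu' := interior_subset hu
    have hsplit : Q u ^ (q - 1) = Q u ^ (q - 2) * Q u := by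
      rw [show q - 1 = (q - 2) + 1 by ring, Real.rpow_add_one (hQpos u).ne']
    have hle : (ε + R) ^ (q - 1) ≤ Q u ^ (q - 1) := by
      refine Real.rpow_le_rpow_of_nonpos (hQpos u) ?_ (by rw [hq]; linarith)
      simp only [hQ]; linarith [hR u hu']
    have hdisc : (s + 2 * B * u) ^ 2 ≤ 4 * B * Q u := by
      simp only [hQ]; nlinarith [mul_nonneg hB hε.le]
    have hq2 : 0 ≤ Q u ^ (q - 2) := Real.rpow_nonneg (hQpos u).le _
    have h3 : (1 - q) * q * ((s + 2 * B * u) ^ 2 * Q u ^ (q - 2))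
        ≤ (1 - q) * q * (4 * B * Q u * Q u ^ (q - 2)) := by
      have : 0 ≤ (1 - q) * q := by
        apply mul_nonneg <;> rw [hq] <;> linarith
      gcongr
    have h4 : κ ≤ p * (p - 1) * B * Q u ^ (q - 1) := by
      have : 0 ≤ p * (p - 1) * B := mul_nonneg (mul_nonneg (by linarith) (by linarith)) hB
      rw [hκ]; gcongr
    have h5 : p * (p - 1) * B * Q u ^ (q - 1)
        = 2 * B * q * Q u ^ (q - 1) - (1 - q) * q * (4 * B * Q u * Q u ^ (q - 2)) := by
      rw [hsplit, hq]; ring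
    nlinarith
  have hc2 := hconv.2
  have hmid := hc2 (show (-1 : ℝ) ∈ Set.Icc (-1 : ℝ) 1 by simp)
    (show (1 : ℝ) ∈ Set.Icc (-1 : ℝ) 1 by simp)
    (show (0 : ℝ) ≤ 1 / 2 by norm_num) (show (0 : ℝ) ≤ 1 / 2 by norm_num) (by norm_num)
  simp only [hQ, smul_eq_mul] at hmid
  norm_num at hmid
  have e2 : ε + (A + -s + B) = ε + (A - s + B) := by ring
  rw [e2] at hmid
  linarith

variable {E : Type*} [NormedAddCommGroup E] [InnerProductSpace ℝ E]

/-- Quantitative midpoint convexity of `‖·‖ ^ p` on a Hilbert space. -/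
theorem norm_rpow_midpoint {p : ℝ} (hp1 : 1 < p) (hp2 : p < 2) (a b : E) :
    2 * ‖a‖ ^ p + p * (p - 1) * (‖b‖ ^ 2 * (‖a‖ + ‖b‖) ^ (p - 2))
      ≤ ‖a + b‖ ^ p + ‖a - b‖ ^ p := by
  -- Treated apart because `p / 2 - 1` is negative: the limit `ε → 0` below needs a nonzero base.
  by_cases h0 : ‖a‖ + ‖b‖ = 0
  · have ha : a = 0 := norm_eq_zero.1 (by linarith [norm_nonneg a, norm_nonneg b])
    have hb : b = 0 := norm_eq_zero.1 (by linarith [norm_nonneg a, norm_nonneg b])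
    have : p ≠ 0 := by linarith
    simp [ha, hb, this]
  have hpos : 0 < ‖a‖ + ‖b‖ :=
    lt_of_le_of_ne (by positivity) (Ne.symm h0)
  have hsq : ∀ v : E, (‖v‖ ^ 2) ^ (p / 2) = ‖v‖ ^ p := by
    intro v
    rw [← Real.rpow_natCast, ← Real.rpow_mul (norm_nonneg _)]
    congr 1; push_cast; ring
  have key : ∀ ε : ℝ, 0 < ε →
      2 * (ε + ‖a‖ ^ 2) ^ (p / 2)
        + p * (p - 1) * ‖b‖ ^ 2 * (ε + (‖a‖ + ‖b‖) ^ 2) ^ (p / 2 - 1)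
      ≤ (ε + ‖a + b‖ ^ 2) ^ (p / 2) + (ε + ‖a - b‖ ^ 2) ^ (p / 2) := by
    intro ε hε
    have hin := abs_real_inner_le_norm a b
    rw [norm_add_sq_real, norm_sub_sq_real]
    refine rpow_quadratic_midpoint hp1 hp2 hε (by positivity) (by positivity) ?_ ?_
    · have : (inner ℝ a b) ^ 2 ≤ (‖a‖ * ‖b‖) ^ 2 := sq_le_sq' (neg_le_of_abs_le hin)
        (le_of_abs_le hin)
      nlinarith
    · intro u hu
      have hu1 : |u| ≤ 1 := abs_le.2 hu
      have h1 : 2 * inner ℝ a b * u ≤ 2 * (‖a‖ * ‖b‖) := by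
        calc 2 * inner ℝ a b * u ≤ |2 * inner ℝ a b * u| := le_abs_self _
          _ = 2 * |inner ℝ a b| * |u| := by rw [abs_mul, abs_mul]; simp
          _ ≤ 2 * (‖a‖ * ‖b‖) * 1 := by gcongr
          _ = _ := by ring
      have h2 : ‖b‖ ^ 2 * u ^ 2 ≤ ‖b‖ ^ 2 * 1 := by
        gcongr; exact (sq_le_one_iff_abs_le_one u).2 hu1
      nlinarith
  have hlim : ∀ {c e : ℝ}, c ≠ 0 ∨ 0 ≤ e → Tendsto (fun ε : ℝ => (ε + c) ^ e)
      (nhdsWithin 0 (Set.Ioi 0)) (nhds (c ^ e)) := by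
    intro c e hc
    have : ContinuousAt (fun ε : ℝ => (ε + c) ^ e) 0 :=
      ContinuousAt.rpow_const (by fun_prop) (by simpa using hc)
    have h := this.tendsto.mono_left (nhdsWithin_le_nhds (s := Set.Ioi 0))
    simpa using h
  have hq : (0 : ℝ) ≤ p / 2 := by linarith
  have := le_of_tendsto_of_tendsto
    (((hlim (c := ‖a‖ ^ 2) (Or.inr hq)).const_mul 2).add
      ((hlim (c := (‖a‖ + ‖b‖) ^ 2) (e := p / 2 - 1) (Or.inl (by positivity))).const_mul
        (p * (p - 1) * ‖b‖ ^ 2)))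
    ((hlim (c := ‖a + b‖ ^ 2) (Or.inr hq)).add (hlim (c := ‖a - b‖ ^ 2) (Or.inr hq)))
    (eventually_nhdsWithin_of_forall fun ε hε => key ε hε)
  have hw : ((‖a‖ + ‖b‖) ^ 2) ^ (p / 2 - 1) = (‖a‖ + ‖b‖) ^ (p - 2) := by
    rw [← Real.rpow_natCast, ← Real.rpow_mul hpos.le]
    congr 1; push_cast; ring
  rw [hsq, hsq, hsq, hw] at this
  linarith

end EmpiricalProcess

/-! ### Loss of `L^p` norm under conditional expectation -/

namespace EmpiricalProcess

theorem lpNorm_ofReal_rpow {Ω E : Type*} [MeasurableSpace Ω] {P : Measure Ω}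
    [NormedAddCommGroup E] {p : ℝ} (hp : 0 < p) {f : Ω → E} (hf : AEStronglyMeasurable f P) :
    lpNorm f (ENNReal.ofReal p) P ^ p = ∫ ω, ‖f ω‖ ^ p ∂P := by
  rw [lpNorm_eq_integral_norm_rpow_toReal (by simpa using hp) ENNReal.ofReal_ne_top hf,
    ENNReal.toReal_ofReal hp.le, ← Real.rpow_mul (by positivity), inv_mul_cancel₀ hp.ne',
    Real.rpow_one]

theorem _root_.MeasureTheory.MemLp.integrable_norm_rpow_ofReal {Ω E : Type*} [MeasurableSpace Ω] {P : Measure Ω}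
    [NormedAddCommGroup E] {p : ℝ} (hp : 0 < p) {f : Ω → E} (hf : MemLp f (ENNReal.ofReal p) P) :
    Integrable (fun ω => ‖f ω‖ ^ p) P := by
  have := hf.integrable_norm_rpow (by simpa using hp) ENNReal.ofReal_ne_top
  rwa [ENNReal.toReal_ofReal hp.le] at this

/-- Bernoulli's inequality at `b / a`: the graph of `x ↦ x ^ p` lies above its tangent at `a`. -/
theorem rpow_sub_rpow_le_mul {p a b : ℝ} (hp : 1 ≤ p) (hb : 0 ≤ b) (ha : 0 < a) :
    a ^ p - b ^ p ≤ p * a ^ (p - 1) * (a - b) := by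
  have h := one_add_mul_self_le_rpow_one_add (s := b / a - 1) (by
    have : 0 ≤ b / a := by positivity
    linarith) hp
  rw [add_sub_cancel, Real.div_rpow hb ha.le] at h
  have hap : 0 < a ^ p := Real.rpow_pos_of_pos ha p
  have h2 := mul_le_mul_of_nonneg_left h hap.le
  rw [mul_div_cancel₀ _ hap.ne'] at h2
  have h3 : a ^ p = a ^ (p - 1) * a := by
    rw [← Real.rpow_add_one ha.ne', sub_add_cancel]
  have h4 : a ^ p * (1 + p * (b / a - 1)) = a ^ p - p * a ^ (p - 1) * (a - b) := by
    rw [h3]; field_simp; ring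
  linarith

/-- The `L^p` norm of `g - E(g | m)` is controlled by the decrease of the `L^p` norm under
conditional expectation. -/
theorem sq_lpNorm_sub_condExp_le {Ω E : Type*} {m mΩ : MeasurableSpace Ω} {P : Measure Ω}
    [IsProbabilityMeasure P] [NormedAddCommGroup E] [InnerProductSpace ℝ E] [CompleteSpace E]
    {p : ℝ} (hp1 : 1 < p) (hp2 : p < 2) (hm : m ≤ mΩ)
    {f g : Ω → E} (hg : MemLp g (ENNReal.ofReal p) P) (hf : f =ᵐ[P] P[g | m]) :
    lpNorm (g - f) (ENNReal.ofReal p) P ^ 2 ≤ 8 / (p - 1) * (lpNorm g (ENNReal.ofReal p) P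
      * (lpNorm g (ENNReal.ofReal p) P - lpNorm f (ENNReal.ofReal p) P)) := by
  set r := ENNReal.ofReal p with hr
  have hp0 : 0 < p := by linarith
  have hr1 : 1 ≤ r := by rw [hr, ← ENNReal.ofReal_one]; exact ENNReal.ofReal_le_ofReal hp1.le
  have hfL : MemLp f r P := (hg.condExp hr1).ae_eq hf.symm
  -- Midpoint and half difference of `g` and `f`. Since the midpoint also has conditional
  -- expectation `f`, its `L^p` norm is at least that of `f`, so integrating the midpoint inequality
  -- leaves only `A ^ p - F ^ p` on the right.
  set a : Ω → E := fun ω => (1 / 2 : ℝ) • (g ω + f ω) with ha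
  set b : Ω → E := fun ω => (1 / 2 : ℝ) • (g ω - f ω) with hb
  have haL : MemLp a r P := (hg.add hfL).const_smul (1 / 2 : ℝ)
  have hbL : MemLp b r P := (hg.sub hfL).const_smul (1 / 2 : ℝ)
  have hab : ∀ ω, a ω + b ω = g ω := fun ω => by
    simp only [ha, hb, ← smul_add]; rw [add_add_sub_cancel, ← two_smul ℝ, smul_smul]; simp
  have hab' : ∀ ω, a ω - b ω = f ω := fun ω => by
    simp only [ha, hb, ← smul_sub]; rw [add_sub_sub_cancel, ← two_smul ℝ, smul_smul]; simp
  have hfa : f =ᵐ[P] P[a | m] := by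
    have hgi := hg.integrable hr1
    have hfi := hfL.integrable hr1
    have h1 : P[a | m] =ᵐ[P] (1 / 2 : ℝ) • P[g + f | m] := condExp_smul (1 / 2 : ℝ) (g + f) m
    have h2 := condExp_add hgi hfi m
    have h3 : P[f | m] =ᵐ[P] P[g | m] :=
      (condExp_congr_ae hf).trans (condExp_condExp_of_le le_rfl hm)
    filter_upwards [h1, h2, h3, hf] with ω e1 e2 e3 e4
    rw [e1, Pi.smul_apply, e2, Pi.add_apply, e3, e4, ← two_smul ℝ, smul_smul]; simp
  have hfa_le : ∫ ω, ‖f ω‖ ^ p ∂P ≤ ∫ ω, ‖a ω‖ ^ p ∂P := by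
    rw [integral_congr_ae (g := fun ω => ‖(P[a | m]) ω‖ ^ p)
      (hfa.mono fun ω h => by simp only [h])]
    exact integral_norm_condExp_rpow_le hp1.le (haL.integrable_norm_rpow_ofReal hp0)
  have hf_le : lpNorm f r P ≤ lpNorm g r P := by
    have : lpNorm f r P = lpNorm (P[g | m]) r P := by
      rw [← toReal_eLpNorm hfL.1, eLpNorm_congr_ae hf, toReal_eLpNorm (hg.condExp hr1).1]
    rw [this]; exact hg.lpNorm_condExp_le_lpNorm hr1
  set w : Ω → ℝ := fun ω => ‖a ω‖ + ‖b ω‖ with hw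
  have hw0 : ∀ ω, 0 ≤ w ω := fun ω => by positivity
  have hwL : MemLp w r P := haL.norm.add hbL.norm
  have hpt : ∀ ω, p * (p - 1) * (‖b ω‖ ^ 2 * w ω ^ (p - 2))
      ≤ ‖g ω‖ ^ p + ‖f ω‖ ^ p - 2 * ‖a ω‖ ^ p := by
    intro ω
    have := norm_rpow_midpoint hp1 hp2 (a ω) (b ω)
    rw [hab, hab'] at this
    linarith
  have hpp : 0 < p * (p - 1) := mul_pos hp0 (by linarith)
  have hsum : Integrable (fun ω => ‖g ω‖ ^ p + ‖f ω‖ ^ p) P :=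
    (hg.integrable_norm_rpow_ofReal hp0).add (hfL.integrable_norm_rpow_ofReal hp0)
  have hRint : Integrable (fun ω => ‖g ω‖ ^ p + ‖f ω‖ ^ p - 2 * ‖a ω‖ ^ p) P :=
    hsum.sub ((haL.integrable_norm_rpow_ofReal hp0).const_mul 2)
  have hJ0 : ∀ ω, 0 ≤ ‖b ω‖ ^ 2 * w ω ^ (p - 2) := fun ω =>
    mul_nonneg (sq_nonneg _) (Real.rpow_nonneg (hw0 ω) _)
  have hJm : AEMeasurable (fun ω => ‖b ω‖ ^ 2 * w ω ^ (p - 2)) P :=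
    (hbL.1.norm.aemeasurable.pow_const 2).mul (hwL.1.aemeasurable.pow_const _)
  have hJint : Integrable (fun ω => ‖b ω‖ ^ 2 * w ω ^ (p - 2)) P := by
    refine (hRint.const_mul (p * (p - 1))⁻¹).mono' hJm.aestronglyMeasurable
      (ae_of_all _ fun ω => ?_)
    rw [Real.norm_of_nonneg (hJ0 ω), inv_mul_eq_div, le_div_iff₀ hpp, mul_comm]
    exact hpt ω
  set J := ∫ ω, ‖b ω‖ ^ 2 * w ω ^ (p - 2) ∂P with hJ
  set A := lpNorm g r P with hA
  set F := lpNorm f r P with hF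
  have hA0 : 0 ≤ A := lpNorm_nonneg
  have hF0 : 0 ≤ F := lpNorm_nonneg
  have hJle : p * (p - 1) * J ≤ A ^ p - F ^ p := by
    rw [hA, hF, lpNorm_ofReal_rpow hp0 hg.1, lpNorm_ofReal_rpow hp0 hfL.1, hJ]
    have := integral_mono (hJint.const_mul (p * (p - 1))) hRint hpt
    rw [integral_sub hsum ((haL.integrable_norm_rpow_ofReal hp0).const_mul 2),
      integral_add (hg.integrable_norm_rpow_ofReal hp0) (hfL.integrable_norm_rpow_ofReal hp0),
      integral_const_mul, integral_const_mul] at this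
    linarith
  -- The tangent inequality and the cancellation of powers of `A` below need `A > 0`.
  rcases hA0.eq_or_lt with hA00 | hApos
  · have hF00 : F = 0 := le_antisymm (hA00 ▸ hf_le) hF0
    have : lpNorm (g - f) r P ≤ A + F := lpNorm_sub_le hg hr1
    have h0 : lpNorm (g - f) r P = 0 := le_antisymm (by linarith) lpNorm_nonneg
    rw [h0, ← hA00]; simp
  have hw_le : lpNorm w r P ≤ 2 * A := by
    have h1 : lpNorm w r P ≤ lpNorm (fun ω => ‖g ω‖ + ‖f ω‖) r P := by
      refine lpNorm_mono_real (hg.norm.add hfL.norm) fun ω => ?_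
      rw [Real.norm_of_nonneg (hw0 ω)]
      have h1 : ‖a ω‖ ≤ (‖g ω‖ + ‖f ω‖) / 2 := by
        simp only [ha, norm_smul]; norm_num; linarith [norm_add_le (g ω) (f ω)]
      have h2 : ‖b ω‖ ≤ (‖g ω‖ + ‖f ω‖) / 2 := by
        simp only [hb, norm_smul]; norm_num; linarith [norm_sub_le (g ω) (f ω)]
      simp only [hw]; linarith
    have h2 := lpNorm_add_le hg.norm (g := fun ω => ‖f ω‖) hr1
    rw [lpNorm_norm hg.1, lpNorm_norm hfL.1] at h2
    have h3 : (fun ω => ‖g ω‖) + (fun ω => ‖f ω‖) = fun ω => ‖g ω‖ + ‖f ω‖ := rfl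
    rw [h3] at h2
    linarith
  have hWint := hwL.integrable_norm_rpow_ofReal hp0
  have hW : ∫ ω, ‖w ω‖ ^ p ∂P ≤ (2 * A) ^ p := by
    rw [← lpNorm_ofReal_rpow hp0 hwL.1]
    exact Real.rpow_le_rpow lpNorm_nonneg hw_le hp0.le
  have hJnn : 0 ≤ J := integral_nonneg hJ0
  -- Hölder applied to `‖b‖^p = (‖b‖² w^(p-2))^(p/2) (w^p)^(1-p/2)`. Where `w` vanishes so does `b`,
  -- and both sides are zero.
  have hHolder : ∫ ω, ‖b ω‖ ^ p ∂P ≤ J ^ (p / 2) * (∫ ω, ‖w ω‖ ^ p ∂P) ^ (1 - p / 2) := by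
    have h := ENNReal.lintegral_mul_norm_pow_le (μ := P)
      (f := fun ω => ENNReal.ofReal (‖b ω‖ ^ 2 * w ω ^ (p - 2)))
      (g := fun ω => ENNReal.ofReal (‖w ω‖ ^ p)) hJm.ennreal_ofReal
      hWint.1.aemeasurable.ennreal_ofReal
      (p := p / 2) (q := 1 - p / 2) (by linarith) (by linarith) (by ring)
    rw [← ofReal_integral_eq_lintegral_ofReal hJint (ae_of_all _ hJ0),
      ← ofReal_integral_eq_lintegral_ofReal hWint (ae_of_all _ fun ω => by positivity)] at h
    have hpe : ∀ ω, ENNReal.ofReal (‖b ω‖ ^ 2 * w ω ^ (p - 2)) ^ (p / 2)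
        * ENNReal.ofReal (‖w ω‖ ^ p) ^ (1 - p / 2) = ENNReal.ofReal (‖b ω‖ ^ p) := by
      intro ω
      rw [ENNReal.ofReal_rpow_of_nonneg (hJ0 ω) (by linarith),
        ENNReal.ofReal_rpow_of_nonneg (by positivity) (by linarith),
        ← ENNReal.ofReal_mul (Real.rpow_nonneg (hJ0 ω) _), Real.norm_of_nonneg (hw0 ω)]
      congr 1
      rcases (hw0 ω).eq_or_lt with h0 | hwp
      · have hb0 : ‖b ω‖ = 0 := by
          have := norm_nonneg (a ω); have := norm_nonneg (b ω)
          simp only [hw] at h0; linarith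
        have : p / 2 ≠ 0 := by positivity
        rw [hb0]; simp [hp0.ne', this]
      · rw [Real.mul_rpow (by positivity) (Real.rpow_nonneg (hw0 ω) _), ← Real.rpow_mul hwp.le,
          ← Real.rpow_mul hwp.le, mul_assoc, ← Real.rpow_add hwp,
          show (p - 2) * (p / 2) + p * (1 - p / 2) = 0 by ring, Real.rpow_zero, mul_one,
          ← Real.rpow_natCast, ← Real.rpow_mul (norm_nonneg _)]
        congr 1; push_cast; ring
    simp only [hpe] at h
    rw [← ofReal_integral_eq_lintegral_ofReal (hbL.integrable_norm_rpow_ofReal hp0)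
      (ae_of_all _ fun ω => by positivity), ENNReal.ofReal_rpow_of_nonneg hJnn (by linarith),
      ENNReal.ofReal_rpow_of_nonneg (integral_nonneg fun ω => by positivity) (by linarith),
      ← ENNReal.ofReal_mul (by positivity)] at h
    exact (ENNReal.ofReal_le_ofReal_iff (by positivity)).1 h
  have hbn : lpNorm b r P = lpNorm (g - f) r P / 2 := by
    have := lpNorm_const_smul (p := r) (1 / 2 : ℝ) (g - f) P
    have e : b = (1 / 2 : ℝ) • (g - f) := rfl
    rw [e, this]; norm_num; ring
  rw [← lpNorm_ofReal_rpow hp0 hbL.1, hbn] at hHolder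
  set δ := lpNorm (g - f) r P with hδ
  have hδ0 : 0 ≤ δ := lpNorm_nonneg
  have h1 : (δ / 2) ^ p ≤ J ^ (p / 2) * ((2 * A) ^ p) ^ (1 - p / 2) := by
    refine hHolder.trans ?_
    gcongr
    linarith
  have h2 : (δ / 2) ^ 2 ≤ J * (2 * A) ^ (2 - p) := by
    have h := Real.rpow_le_rpow (by positivity) h1 (show 0 ≤ 2 / p by positivity)
    rw [← Real.rpow_mul (by positivity), Real.mul_rpow (by positivity) (by positivity),
      ← Real.rpow_mul hJnn, ← Real.rpow_mul (by positivity), ← Real.rpow_mul (by positivity)] at h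
    have e1 : p * (2 / p) = 2 := by field_simp
    have e2 : p / 2 * (2 / p) = 1 := by field_simp
    have e3 : p * ((1 - p / 2) * (2 / p)) = 2 - p := by field_simp
    rw [e1, e2, e3, Real.rpow_one, Real.rpow_two] at h
    exact h
  have h3 : J ≤ (p - 1)⁻¹ * (A ^ (p - 1) * (A - F)) := by
    have := hJle.trans (rpow_sub_rpow_le_mul hp1.le hF0 hApos)
    rw [inv_mul_eq_div, le_div_iff₀ (by linarith)]
    nlinarith
  have h4 : (2 * A) ^ (2 - p) ≤ 2 * A ^ (2 - p) := by
    rw [Real.mul_rpow (by norm_num) hA0]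
    gcongr
    calc (2 : ℝ) ^ (2 - p) ≤ 2 ^ (1 : ℝ) :=
          Real.rpow_le_rpow_of_exponent_le (by norm_num) (by linarith)
      _ = 2 := Real.rpow_one _
  have h5 : A ^ (p - 1) * A ^ (2 - p) = A := by
    rw [← Real.rpow_add hApos]; norm_num
  have h6 : (δ / 2) ^ 2 ≤ (p - 1)⁻¹ * (A ^ (p - 1) * (A - F)) * (2 * A ^ (2 - p)) :=
    h2.trans (mul_le_mul h3 h4 (by positivity) (hJnn.trans h3))
  have h7 : (p - 1)⁻¹ * (A ^ (p - 1) * (A - F)) * (2 * A ^ (2 - p))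
      = 2 * (p - 1)⁻¹ * ((A ^ (p - 1) * A ^ (2 - p)) * (A - F)) := by ring
  rw [h7, h5] at h6
  rw [div_eq_mul_inv]
  nlinarith

end EmpiricalProcess

namespace EmpiricalProcess

/-! ### A summability criterion -/

/-- Abel summation, with `√(k+1) - √k ≤ 1 / √(k+1)`. -/
theorem sum_sqrt_mul_sub_le {a : ℕ → ℝ} (ha0 : ∀ k, 0 ≤ a k) (K : ℕ) :
    ∑ k ∈ Finset.range K, √(k + 1) * (a k - a (k + 1))
      ≤ ∑ k ∈ Finset.range K, a k / √(k + 1) := by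
  -- The boundary term `√K * a K` is what makes the induction close; it is nonnegative and dropped
  -- at the end.
  have h : ∀ K : ℕ, ∑ k ∈ Finset.range K, √((k : ℝ) + 1) * (a k - a (k + 1)) + √(K : ℝ) * a K
      ≤ ∑ k ∈ Finset.range K, a k / √((k : ℝ) + 1) := by
    intro K
    induction K with
    | zero => simp
    | succ K ih =>
      rw [Finset.sum_range_succ, Finset.sum_range_succ]
      have h1 : (√((K : ℝ) + 1) - √(K : ℝ)) * a K ≤ a K / √((K : ℝ) + 1) := by
        rw [div_eq_inv_mul]
        refine mul_le_mul_of_nonneg_right ?_ (ha0 K)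
        have hs : 0 < √((K : ℝ) + 1) := Real.sqrt_pos.2 (by positivity)
        rw [← one_div, le_div_iff₀ hs]
        have e1 := Real.mul_self_sqrt (show (0 : ℝ) ≤ K + 1 by positivity)
        have e2 := Real.mul_self_sqrt (show (0 : ℝ) ≤ K by positivity)
        have e3 : √(K : ℝ) ≤ √((K : ℝ) + 1) := Real.sqrt_le_sqrt (by linarith)
        nlinarith [Real.sqrt_nonneg (K : ℝ)]
      push_cast
      linarith
  refine le_trans ?_ (h K)
  have := mul_nonneg (Real.sqrt_nonneg (K : ℝ)) (ha0 K)
  linarith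

/-- The product `a_k (a_k - a_{k+1})` factors as `x_k y_k` with `x_k = a_k / √(k+1)` and `y_k =
√(k+1) (a_k - a_{k+1})`, both summable, and `x y ≤ (x + y)²`. This is where the weight `1 / √k` of
the projective condition comes from. -/
theorem summable_of_sq_le_mul_sub {a δ : ℕ → ℝ} {C : ℝ} (hC : 0 ≤ C) (ha0 : ∀ k, 0 ≤ a k)
    (ha : Antitone a) (hδ0 : ∀ k, 0 ≤ δ k) (hδ : ∀ k, δ k ^ 2 ≤ C * (a k * (a k - a (k + 1))))
    (hs : Summable fun k : ℕ => a k / √(k + 1)) : Summable δ := by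
  have hb : Summable fun k : ℕ => √((k : ℝ) + 1) * (a k - a (k + 1)) := by
    refine summable_of_sum_range_le (c := ∑' k : ℕ, a k / √((k : ℝ) + 1)) (fun k => ?_) fun K => ?_
    · exact mul_nonneg (Real.sqrt_nonneg _) (sub_nonneg.2 (ha (Nat.le_succ k)))
    · exact (sum_sqrt_mul_sub_le ha0 K).trans
        (hs.sum_le_tsum _ fun k _ => div_nonneg (ha0 k) (Real.sqrt_nonneg _))
  refine Summable.of_nonneg_of_le hδ0 (fun k => ?_) ((hs.add hb).mul_left √C)
  have hk : 0 < √((k : ℝ) + 1) := Real.sqrt_pos.2 (by positivity)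
  have hx : 0 ≤ a k / √((k : ℝ) + 1) := div_nonneg (ha0 k) hk.le
  have hy : 0 ≤ √((k : ℝ) + 1) * (a k - a (k + 1)) :=
    mul_nonneg hk.le (sub_nonneg.2 (ha (Nat.le_succ k)))
  have hxy : a k / √((k : ℝ) + 1) * (√((k : ℝ) + 1) * (a k - a (k + 1)))
      = a k * (a k - a (k + 1)) := by field_simp
  refine abs_le_of_sq_le_sq' ?_ (by positivity) |>.2
  rw [mul_pow, Real.sq_sqrt hC]
  refine (hδ k).trans (mul_le_mul_of_nonneg_left ?_ hC)
  rw [← hxy]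
  nlinarith [mul_nonneg hx hy]

end EmpiricalProcess

namespace EmpiricalProcess

/-! ### Maximal inequalities for Hilbert space valued martingales -/

theorem integrable_inner_of_memLp_two {Ω E : Type*} {mΩ : MeasurableSpace Ω} {P : Measure Ω}
    [NormedAddCommGroup E] [InnerProductSpace ℝ E] {f g : Ω → E} (hf : MemLp f 2 P) (hg : MemLp g 2 P) :
    Integrable (fun ω => inner ℝ (f ω) (g ω)) P := by
  have hf2 := hf.integrable_norm_pow (by norm_num)
  have hg2 := hg.integrable_norm_pow (by norm_num)
  refine (hf2.add hg2).mono' (hf.1.inner hg.1) (ae_of_all _ fun ω => ?_)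
  have h1 := norm_inner_le_norm (𝕜 := ℝ) (f ω) (g ω)
  simp only [Pi.add_apply]
  nlinarith [sq_nonneg (‖f ω‖ - ‖g ω‖), sq_nonneg (‖f ω‖), sq_nonneg (‖g ω‖)]

theorem stronglyMeasurable_sum_range {Ω E : Type*} {mΩ : MeasurableSpace Ω} [NormedAddCommGroup E]
    (ℱ : Filtration ℕ mΩ) (D : ℕ → Ω → E) (hD : ∀ i, StronglyMeasurable[ℱ (i + 1)] (D i)) (n : ℕ) :
    StronglyMeasurable[ℱ n] fun ω => ∑ i ∈ Finset.range n, D i ω := by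
  refine Finset.stronglyMeasurable_fun_sum _ fun i hi => ?_
  exact (hD i).mono (ℱ.mono (Finset.mem_range.1 hi))

section Doob

variable {Ω E : Type*} {mΩ : MeasurableSpace Ω} {P : Measure Ω} [IsProbabilityMeasure P]
  [NormedAddCommGroup E] [InnerProductSpace ℝ E] [CompleteSpace E]

/-- The factor known at time `m` is pulled out of the conditional expectation, the inner product
being bilinear. This orthogonality of martingale increments is what yields additivity of variances.
-/
theorem integral_inner_eq_zero_of_condExp_eq_zero {m : MeasurableSpace Ω} (hm : m ≤ mΩ)
    {f g : Ω → E} (hfm : StronglyMeasurable[m] f) (hf : MemLp f 2 P) (hg : MemLp g 2 P)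
    (h0 : P[g | m] =ᵐ[P] 0) : ∫ ω, inner ℝ (f ω) (g ω) ∂P = 0 := by
  have h := condExp_bilin_of_stronglyMeasurable_left (innerSL ℝ (E := E)) hfm
    (g := g) (integrable_inner_of_memLp_two hf hg) (hg.integrable (by norm_num))
  have h2 : ∫ ω, inner ℝ (f ω) (g ω) ∂P = ∫ ω, (P[fun ω => innerSL ℝ (f ω) (g ω) | m]) ω ∂P := by
    rw [integral_condExp hm]; rfl
  rw [h2, integral_congr_ae h, integral_congr_ae (g := fun _ => (0 : ℝ)), integral_zero]
  filter_upwards [h0] with ω hω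
  simp [hω]

variable (ℱ : Filtration ℕ mΩ) (D : ℕ → Ω → E)

theorem integral_sq_norm_sum_eq (hD : ∀ i, StronglyMeasurable[ℱ (i + 1)] (D i))
    (hD0 : ∀ i, P[D i | ℱ i] =ᵐ[P] 0) (hD2 : ∀ i, MemLp (D i) 2 P) (n : ℕ) :
    ∫ ω, ‖∑ i ∈ Finset.range n, D i ω‖ ^ 2 ∂P = ∑ i ∈ Finset.range n, ∫ ω, ‖D i ω‖ ^ 2 ∂P := by
  induction n with
  | zero => simp
  | succ n ih =>
    have hM : MemLp (fun ω => ∑ i ∈ Finset.range n, D i ω) 2 P :=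
      memLp_finsetSum _ fun i _ => hD2 i
    have e : ∀ ω, ‖∑ i ∈ Finset.range (n + 1), D i ω‖ ^ 2
        = ‖∑ i ∈ Finset.range n, D i ω‖ ^ 2
          + 2 * inner ℝ (∑ i ∈ Finset.range n, D i ω) (D n ω) + ‖D n ω‖ ^ 2 := by
      intro ω
      rw [Finset.sum_range_succ, norm_add_sq_real]
    have hin := integrable_inner_of_memLp_two hM (hD2 n)
    have hM2 := hM.integrable_norm_pow (by norm_num)
    have hDn2 := (hD2 n).integrable_norm_pow (by norm_num)
    have hs : Integrable (fun ω => ‖∑ i ∈ Finset.range n, D i ω‖ ^ 2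
          + 2 * inner ℝ (∑ i ∈ Finset.range n, D i ω) (D n ω)) P := hM2.add (hin.const_mul 2)
    simp only [e]
    rw [integral_add hs hDn2, integral_add hM2 (hin.const_mul 2), integral_const_mul,
      integral_inner_eq_zero_of_condExp_eq_zero (ℱ.le n) (stronglyMeasurable_sum_range ℱ D hD n)
        hM (hD2 n) (hD0 n), ih, Finset.sum_range_succ]
    ring

/-- The norm of a Hilbert space valued martingale is a submartingale. -/
theorem submartingale_norm_sum (hD : ∀ i, StronglyMeasurable[ℱ (i + 1)] (D i))
    (hD0 : ∀ i, P[D i | ℱ i] =ᵐ[P] 0) (hDi : ∀ i, Integrable (D i) P) :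
    Submartingale (fun n ω => ‖∑ i ∈ Finset.range n, D i ω‖) ℱ P := by
  have hint : ∀ n, Integrable (fun ω => ∑ i ∈ Finset.range n, D i ω) P := fun n =>
    integrable_finsetSum _ fun i _ => hDi i
  refine submartingale_nat (fun n => (stronglyMeasurable_sum_range ℱ D hD n).norm)
    (fun n => (hint n).norm) fun n => ?_
  have h1 := norm_condExp_le (μ := P) (m := ℱ n) fun ω => ∑ i ∈ Finset.range (n + 1), D i ω
  have h2 : P[fun ω => ∑ i ∈ Finset.range (n + 1), D i ω | ℱ n]
      =ᵐ[P] fun ω => ∑ i ∈ Finset.range n, D i ω := by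
    have e : (fun ω => ∑ i ∈ Finset.range (n + 1), D i ω)
        = (fun ω => ∑ i ∈ Finset.range n, D i ω) + D n := by
      funext ω; simp [Finset.sum_range_succ]
    rw [e]
    have h3 := condExp_add (m := ℱ n) (hint n) (hDi n)
    rw [condExp_of_stronglyMeasurable (ℱ.le n) (stronglyMeasurable_sum_range ℱ D hD n) (hint n)]
      at h3
    filter_upwards [h3, hD0 n] with ω e1 e2
    rw [e1, Pi.add_apply, e2]; simp
  filter_upwards [h1, h2] with ω e1 e2
  rwa [e2] at e1

/-- The weak type `L²` maximal inequality. -/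
theorem measure_exists_norm_sum_ge_le (hD : ∀ i, StronglyMeasurable[ℱ (i + 1)] (D i))
    (hD0 : ∀ i, P[D i | ℱ i] =ᵐ[P] 0) (hD2 : ∀ i, MemLp (D i) 2 P) {c : ℝ} (hc : 0 < c) (N : ℕ) :
    P {ω | ∃ n ≤ N, c ≤ ‖∑ i ∈ Finset.range n, D i ω‖}
      ≤ ENNReal.ofReal ((∑ i ∈ Finset.range N, ∫ ω, ‖D i ω‖ ^ 2 ∂P) / c ^ 2) := by
  have hsub := submartingale_norm_sum ℱ D hD hD0 fun i => (hD2 i).integrable (by norm_num)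
  have h := maximal_ineq hsub (fun n ω => norm_nonneg _) (ε := ⟨c, hc.le⟩) N
  have hset : {ω | ∃ n ≤ N, c ≤ ‖∑ i ∈ Finset.range n, D i ω‖}
      = {ω | c ≤ (Finset.range (N + 1)).sup' Finset.nonempty_range_add_one
          fun k => ‖∑ i ∈ Finset.range k, D i ω‖} := by
    ext ω
    simp [Finset.le_sup'_iff]
  rw [hset]
  set S := {ω | c ≤ (Finset.range (N + 1)).sup' Finset.nonempty_range_add_one
          fun k => ‖∑ i ∈ Finset.range k, D i ω‖} with hS
  change ENNReal.ofNNReal ⟨c, hc.le⟩ * P S ≤ ENNReal.ofReal (∫ ω in S, _ ∂P) at h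
  have hM : MemLp (fun ω => ∑ i ∈ Finset.range N, D i ω) 2 P := memLp_finsetSum _ fun i _ => hD2 i
  have hM2 := hM.integrable_norm_pow (by norm_num)
  have hM1 := (hM.integrable (by norm_num)).norm
  rw [← integral_sq_norm_sum_eq ℱ D hD hD0 hD2 N]
  set V := ∫ ω, ‖∑ i ∈ Finset.range N, D i ω‖ ^ 2 ∂P with hV
  have hreal : c * P.real S ≤ ∫ ω in S, ‖∑ i ∈ Finset.range N, D i ω‖ ∂P := by
    have h' := ENNReal.toReal_mono ENNReal.ofReal_ne_top h
    rw [ENNReal.toReal_mul, ENNReal.toReal_ofReal (integral_nonneg fun ω => norm_nonneg _)] at h'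
    exact h'
  -- On `S`, `x ≤ x² / (2c) + c / 2` replaces Cauchy-Schwarz: half of `c * P S` is absorbed into the
  -- left side of Doob's inequality.
  have hle : ∫ ω in S, ‖∑ i ∈ Finset.range N, D i ω‖ ∂P ≤ V / (2 * c) + c / 2 * P.real S := by
    have h1 : ∫ ω in S, ‖∑ i ∈ Finset.range N, D i ω‖ ∂P
        ≤ ∫ ω in S, (‖∑ i ∈ Finset.range N, D i ω‖ ^ 2 / (2 * c) + c / 2) ∂P := by
      refine integral_mono hM1.integrableOn
        ((hM2.div_const (2 * c)).add (integrable_const _)).integrableOn fun ω => ?_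
      have : 0 ≤ (‖∑ i ∈ Finset.range N, D i ω‖ - c) ^ 2 / (2 * c) := by positivity
      have e : (‖∑ i ∈ Finset.range N, D i ω‖ - c) ^ 2 / (2 * c)
        = ‖∑ i ∈ Finset.range N, D i ω‖ ^ 2 / (2 * c) + c / 2
          - ‖∑ i ∈ Finset.range N, D i ω‖ := by field_simp; ring
      linarith
    refine h1.trans ?_
    rw [integral_add (hM2.div_const _).integrableOn (integrable_const _).integrableOn,
      integral_div, setIntegral_const, smul_eq_mul, mul_comm (P.real S)]
    gcongr
    exact setIntegral_le_integral hM2 (ae_of_all _ fun ω => by positivity)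
  rw [← ENNReal.ofReal_toReal (measure_ne_top P S)]
  refine ENNReal.ofReal_le_ofReal ?_
  change P.real S ≤ _
  rw [le_div_iff₀ (by positivity)]
  have h3 : c / 2 * P.real S ≤ V / (2 * c) := by linarith
  have h4 := mul_le_mul_of_nonneg_left h3 (show 0 ≤ 2 * c by positivity)
  rw [mul_div_cancel₀ _ (by positivity)] at h4
  nlinarith

end Doob

section WeakType

/-- A dyadic layer-cake bound: capped at `2 ^ J`, each doubling of the cap costs one more term; then
`J → ∞`, which also covers `x = ∞`. -/
theorem le_one_add_tsum_two_pow (x : ℝ≥0∞) :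
    x ≤ 1 + ∑' j : ℕ, Set.indicator {y : ℝ≥0∞ | 2 ^ j < y} (fun _ => (2 : ℝ≥0∞) ^ j) x := by
  have h : ∀ J : ℕ, min x (2 ^ J)
      ≤ 1 + ∑ j ∈ Finset.range J,
        Set.indicator {y : ℝ≥0∞ | 2 ^ j < y} (fun _ => (2 : ℝ≥0∞) ^ j) x := by
    intro J
    induction J with
    | zero => simp
    | succ J ih =>
      rw [Finset.sum_range_succ, ← add_assoc]
      by_cases hx : 2 ^ J < x
      · rw [Set.indicator_of_mem (by simpa using hx)]
        rw [min_eq_right hx.le] at ih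
        calc min x (2 ^ (J + 1)) ≤ 2 ^ (J + 1) := min_le_right _ _
          _ = 2 ^ J + 2 ^ J := by rw [pow_succ, mul_two]
          _ ≤ _ := by gcongr
      · push Not at hx
        rw [min_eq_left hx] at ih
        exact (min_le_left _ _).trans (ih.trans le_self_add)
  have hb : ∀ J : ℕ, min x (2 ^ J)
      ≤ 1 + ∑' j : ℕ, Set.indicator {y : ℝ≥0∞ | 2 ^ j < y} (fun _ => (2 : ℝ≥0∞) ^ j) x :=
    fun J => (h J).trans (add_le_add_right (ENNReal.sum_le_tsum _) 1)
  have ht : Tendsto (fun J : ℕ => min x ((2 : ℝ≥0∞) ^ J)) atTop (nhds (min x ⊤)) :=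
    tendsto_const_nhds.min (ENNReal.tendsto_nhds_top fun n => by
      filter_upwards [eventually_ge_atTop n] with k hk
      exact_mod_cast hk.trans_lt Nat.lt_two_pow_self)
  rw [min_top_right] at ht
  exact le_of_tendsto' ht hb

/-- Weak type `(2,2)` bounds for a sequence of variables give a first moment bound for the
supremum. -/
theorem lintegral_iSup_le_of_weak {Ω : Type*} [MeasurableSpace Ω] {P : Measure Ω}
    [IsProbabilityMeasure P] {U : ℕ → Ω → ℝ≥0∞} (hU : ∀ r, Measurable (U r)) {b : ℕ → ℝ≥0∞}
    (hb : ∀ r j : ℕ, P {ω | 2 ^ j < U r ω} ≤ b r * (4 ^ j)⁻¹) :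
    ∫⁻ ω, ⨆ r, U r ω ∂P ≤ 1 + 2 * ∑' r, b r := by
  have hm : ∀ j : ℕ, MeasurableSet {ω | (2 : ℝ≥0∞) ^ j < ⨆ r, U r ω} := fun j =>
    measurableSet_lt measurable_const (Measurable.iSup hU)
  calc ∫⁻ ω, ⨆ r, U r ω ∂P
      ≤ ∫⁻ ω, (1 + ∑' j : ℕ, Set.indicator {ω | (2 : ℝ≥0∞) ^ j < ⨆ r, U r ω}
          (fun _ => (2 : ℝ≥0∞) ^ j) ω) ∂P := lintegral_mono fun ω => le_one_add_tsum_two_pow _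
    _ = 1 + ∑' j : ℕ, 2 ^ j * P {ω | (2 : ℝ≥0∞) ^ j < ⨆ r, U r ω} := by
        rw [lintegral_add_left measurable_const, lintegral_const, measure_univ, mul_one,
          lintegral_tsum fun j => (measurable_const.indicator (hm j)).aemeasurable]
        simp_rw [lintegral_indicator_const (hm _)]
    -- Union bound over `r`. What remains in `j` is geometric with ratio `1/2`, hence the factor 2.
    _ ≤ 1 + ∑' j : ℕ, 2 ^ j * ((∑' r, b r) * (4 ^ j)⁻¹) := by
        gcongr with j
        have : {ω | (2 : ℝ≥0∞) ^ j < ⨆ r, U r ω} = ⋃ r, {ω | 2 ^ j < U r ω} := by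
          ext ω; simp [lt_iSup_iff]
        rw [this, ← ENNReal.tsum_mul_right]
        exact (measure_iUnion_le _).trans (ENNReal.tsum_le_tsum fun r => hb r j)
    _ = 1 + 2 * ∑' r, b r := by
        have : ∀ j : ℕ, (2 : ℝ≥0∞) ^ j * ((∑' r, b r) * (4 ^ j)⁻¹)
            = (2⁻¹) ^ j * ∑' r, b r := by
          intro j
          have e : (4 : ℝ≥0∞) ^ j = 2 ^ j * 2 ^ j := by rw [← mul_pow]; norm_num
          rw [e, ENNReal.mul_inv (by simp) (by simp), mul_comm (∑' r, b r), ← mul_assoc, ← mul_assoc,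
            ENNReal.mul_inv_cancel (by simp) (by simp), one_mul, ENNReal.inv_pow]
        simp_rw [this]
        rw [ENNReal.tsum_mul_right, ENNReal.tsum_geometric, ENNReal.one_sub_inv_two, inv_inv]

end WeakType

end EmpiricalProcess

/-! ### Dyadic truncation: level sums and centred truncations -/

namespace EmpiricalProcess

section DyadicSums

/-- The dyadic truncation levels `2^{r/p}`. -/
noncomputable def dyadicLevel (p : ℝ) (r : ℕ) : ℝ := (2 : ℝ) ^ ((r : ℝ) / p)

theorem dyadicLevel_pos (p : ℝ) (r : ℕ) : 0 < dyadicLevel p r :=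
  Real.rpow_pos_of_pos two_pos _

theorem dyadicLevel_succ (p : ℝ) (r : ℕ) :
    dyadicLevel p (r + 1) = 2 ^ (1 / p) * dyadicLevel p r := by
  rw [dyadicLevel, dyadicLevel, ← Real.rpow_add two_pos]
  congr 1; push_cast; ring

theorem dyadicLevel_rpow {p : ℝ} (hp : p ≠ 0) (r : ℕ) : dyadicLevel p r ^ p = 2 ^ r := by
  rw [dyadicLevel, ← Real.rpow_mul two_pos.le, div_mul_cancel₀ _ hp, Real.rpow_natCast]

/-- The terms with `dyadicLevel p r ≥ v` form a geometric series of ratio `ρ < 1`, dominated by its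
first term, of order `v ^ (p - 2)`. Integrated over `v = ‖d‖`, this sums the second moments of the
truncations. -/
theorem sum_dyadicLevel_small_le {p v : ℝ} (hp1 : 1 < p) (hp2 : p < 2) (hv : 0 ≤ v) (R : ℕ) :
    ∑ r ∈ Finset.range R, dyadicLevel p r ^ (p - 2) * (if v ≤ dyadicLevel p r then v ^ 2 else 0)
      ≤ (1 - 2 ^ ((p - 2) / p))⁻¹ * v ^ p := by
  rcases hv.eq_or_lt with rfl | hv
  · have : p ≠ 0 := by linarith
    simp [this]
  have hρ : (2 : ℝ) ^ ((p - 2) / p) < 1 :=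
    Real.rpow_lt_one_of_one_lt_of_neg (by norm_num) (div_neg_of_neg_of_pos (by linarith)
      (by linarith))
  set ρ := (2 : ℝ) ^ ((p - 2) / p) with hρd
  have hsucc : ∀ r, dyadicLevel p (r + 1) ^ (p - 2) = ρ * dyadicLevel p r ^ (p - 2) := by
    intro r
    rw [dyadicLevel_succ, Real.mul_rpow (by positivity) (dyadicLevel_pos p r).le,
      ← Real.rpow_mul two_pos.le, hρd]
    congr 2; ring
  have hmono : ∀ r, dyadicLevel p r ≤ dyadicLevel p (r + 1) := by
    intro r
    refine Real.rpow_le_rpow_of_exponent_le (by norm_num) ?_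
    have : 0 < p := by linarith
    gcongr; simp
  -- Capping the level below by `v` makes `G` constant until the level reaches `v`, so the sum
  -- telescopes with no need to locate the first index.
  set G : ℕ → ℝ := fun r => max v (dyadicLevel p r) ^ (p - 2) with hG
  have hstep : ∀ r, (1 - ρ) * (dyadicLevel p r ^ (p - 2)
      * (if v ≤ dyadicLevel p r then v ^ 2 else 0)) ≤ v ^ 2 * (G r - G (r + 1)) := by
    intro r
    split_ifs with h
    · have e1 : G r = dyadicLevel p r ^ (p - 2) := by simp only [hG]; rw [max_eq_right h]
      have e2 : G (r + 1) = ρ * dyadicLevel p r ^ (p - 2) := by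
        simp only [hG]; rw [max_eq_right (h.trans (hmono r)), hsucc]
      rw [e1, e2]; apply le_of_eq; ring
    · rw [mul_zero, mul_zero]
      refine mul_nonneg (sq_nonneg _) (sub_nonneg.2 ?_)
      exact Real.rpow_le_rpow_of_nonpos (lt_max_of_lt_left hv) (max_le_max le_rfl (hmono r))
        (by linarith)
  have hsum := Finset.sum_le_sum fun r (_ : r ∈ Finset.range R) => hstep r
  rw [← Finset.mul_sum, ← Finset.mul_sum, Finset.sum_range_sub'] at hsum
  have hG0 : G 0 ≤ v ^ (p - 2) :=
    Real.rpow_le_rpow_of_nonpos hv (le_max_left _ _) (by linarith)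
  have hGR : 0 ≤ G R := Real.rpow_nonneg (hv.le.trans (le_max_left _ _)) _
  have hvp : v ^ 2 * v ^ (p - 2) = v ^ p := by
    rw [← Real.rpow_natCast, ← Real.rpow_add hv]; norm_num
  rw [inv_mul_eq_div, le_div_iff₀ (by linarith), mul_comm]
  calc _ ≤ v ^ 2 * (G 0 - G R) := hsum
    _ ≤ v ^ 2 * v ^ (p - 2) := by gcongr; linarith
    _ = v ^ p := hvp

/-- Here the series is increasing, of ratio `σ > 1`, and is dominated by its last term, whose level
is below `v`. It sums the first moments of the parts above the truncation levels. -/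
theorem sum_dyadicLevel_large_le {p v : ℝ} (hp1 : 1 < p) (hv : 0 ≤ v) (R : ℕ) :
    ∑ r ∈ Finset.range R, dyadicLevel p r ^ (p - 1) * (if dyadicLevel p r < v then v else 0)
      ≤ 2 ^ ((p - 1) / p) * (2 ^ ((p - 1) / p) - 1)⁻¹ * v ^ p := by
  have hσ : 1 < (2 : ℝ) ^ ((p - 1) / p) :=
    Real.one_lt_rpow (by norm_num) (div_pos (by linarith) (by linarith))
  set σ := (2 : ℝ) ^ ((p - 1) / p) with hσd
  rcases hv.eq_or_lt with rfl | hv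
  · have : p ≠ 0 := by linarith
    simp [this, (dyadicLevel_pos p _).not_gt]
  have hsucc : ∀ r, dyadicLevel p (r + 1) ^ (p - 1) = σ * dyadicLevel p r ^ (p - 1) := by
    intro r
    rw [dyadicLevel_succ, Real.mul_rpow (by positivity) (dyadicLevel_pos p r).le,
      ← Real.rpow_mul two_pos.le, hσd]
    congr 2; ring
  have hmono : ∀ r, dyadicLevel p r ≤ dyadicLevel p (r + 1) := by
    intro r
    refine Real.rpow_le_rpow_of_exponent_le (by norm_num) ?_
    have : 0 < p := by linarith
    gcongr; simp
  have h2p : 1 ≤ (2 : ℝ) ^ (1 / p) := Real.one_le_rpow (by norm_num) (by positivity)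
  -- The cap is `2^(1/p) * v` and not `v`: if level `r` is below `v`, level `r + 1` is still below
  -- the cap and the increment is the full geometric one.
  set H : ℕ → ℝ := fun r => min (dyadicLevel p r) (2 ^ (1 / p) * v) ^ (p - 1) with hH
  have hstep : ∀ r, (σ - 1) * (dyadicLevel p r ^ (p - 1)
      * (if dyadicLevel p r < v then v else 0)) ≤ v * (H (r + 1) - H r) := by
    intro r
    split_ifs with h
    · have e1 : H r = dyadicLevel p r ^ (p - 1) := by
        simp only [hH]; rw [min_eq_left (by nlinarith)]
      have e2 : H (r + 1) = σ * dyadicLevel p r ^ (p - 1) := by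
        simp only [hH]
        rw [min_eq_left, hsucc]
        rw [dyadicLevel_succ]; gcongr
      rw [e1, e2]; apply le_of_eq; ring
    · rw [mul_zero, mul_zero]
      refine mul_nonneg hv.le (sub_nonneg.2 ?_)
      exact Real.rpow_le_rpow (le_min (dyadicLevel_pos p r).le (by positivity))
        (min_le_min (hmono r) le_rfl) (by linarith)
  have hsum := Finset.sum_le_sum fun r (_ : r ∈ Finset.range R) => hstep r
  rw [← Finset.mul_sum, ← Finset.mul_sum, Finset.sum_range_sub] at hsum
  have hHR : H R ≤ σ * v ^ (p - 1) := by
    have : H R ≤ (2 ^ (1 / p) * v) ^ (p - 1) :=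
      Real.rpow_le_rpow (le_min (dyadicLevel_pos p R).le (by positivity)) (min_le_right _ _)
        (by linarith)
    refine this.trans (le_of_eq ?_)
    rw [Real.mul_rpow (by positivity) hv.le, ← Real.rpow_mul two_pos.le, hσd]
    congr 2; ring
  have hH0 : 0 ≤ H 0 := Real.rpow_nonneg (le_min (dyadicLevel_pos p 0).le (by positivity)) _
  have hvp : v * v ^ (p - 1) = v ^ p := by
    rw [mul_comm, ← Real.rpow_add_one hv.ne', sub_add_cancel]
  rw [mul_comm σ, mul_assoc, inv_mul_eq_div, le_div_iff₀ (by linarith), mul_comm]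
  calc _ ≤ v * (H R - H 0) := hsum
    _ ≤ v * (σ * v ^ (p - 1)) := by gcongr; linarith
    _ = σ * v ^ p := by rw [← hvp]; ring

end DyadicSums

section Truncation

variable {Ω E : Type*} {m mΩ : MeasurableSpace Ω} [NormedAddCommGroup E]

/-- The truncation of `d` at level `y`. -/
noncomputable def smallPart (y : ℝ) (d : Ω → E) : Ω → E := Set.indicator {ω | ‖d ω‖ ≤ y} d

/-- The part of `d` above level `y`. -/
noncomputable def largePart (y : ℝ) (d : Ω → E) : Ω → E := Set.indicator {ω | y < ‖d ω‖} d

theorem smallPart_add_largePart (y : ℝ) (d : Ω → E) : smallPart y d + largePart y d = d := by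
  funext ω
  by_cases h : ‖d ω‖ ≤ y
  · simp [smallPart, largePart, h, h.not_gt]
  · simp [smallPart, largePart, h, not_le.1 h]

theorem norm_smallPart_le {y : ℝ} (hy : 0 ≤ y) (d : Ω → E) (ω : Ω) : ‖smallPart y d ω‖ ≤ y := by
  by_cases h : ‖d ω‖ ≤ y <;> simp [smallPart, h, hy]

theorem sq_norm_smallPart (y : ℝ) (d : Ω → E) (ω : Ω) :
    ‖smallPart y d ω‖ ^ 2 = if ‖d ω‖ ≤ y then ‖d ω‖ ^ 2 else 0 := by
  by_cases h : ‖d ω‖ ≤ y <;> simp [smallPart, h]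

theorem norm_largePart (y : ℝ) (d : Ω → E) (ω : Ω) :
    ‖largePart y d ω‖ = if y < ‖d ω‖ then ‖d ω‖ else 0 := by
  by_cases h : y < ‖d ω‖ <;> simp [largePart, h]

theorem stronglyMeasurable_smallPart {d : Ω → E}
    (hd : StronglyMeasurable[m] d) (y : ℝ) : StronglyMeasurable[m] (smallPart y d) :=
  hd.indicator (hd.norm.measurable measurableSet_Iic)

theorem stronglyMeasurable_largePart {d : Ω → E}
    (hd : StronglyMeasurable[m] d) (y : ℝ) : StronglyMeasurable[m] (largePart y d) :=
  hd.indicator (hd.norm.measurable measurableSet_Ioi)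

variable {P : Measure Ω} [NormedSpace ℝ E] [CompleteSpace E]

/-- Centering with respect to a conditional expectation. -/
noncomputable def condCenter (m : MeasurableSpace Ω) {mΩ : MeasurableSpace Ω} (P : Measure Ω) (f : Ω → E) : Ω → E := f - P[f | m]

theorem condExp_condCenter [IsFiniteMeasure P] (hm : m ≤ mΩ) {f : Ω → E}
    (hf : Integrable f P) : P[condCenter m P f | m] =ᵐ[P] 0 := by
  have h1 := condExp_sub hf (integrable_condExp (f := f) (m := m) (μ := P)) m
  have h2 := condExp_of_stronglyMeasurable hm (stronglyMeasurable_condExp (f := f) (μ := P))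
    integrable_condExp
  rw [h2] at h1
  rwa [sub_self] at h1

theorem integral_sq_norm_condCenter_le {f : Ω → E}
    (hf : MemLp f 2 P) : ∫ ω, ‖condCenter m P f ω‖ ^ 2 ∂P ≤ 4 * ∫ ω, ‖f ω‖ ^ 2 ∂P := by
  have hc : MemLp (P[f | m]) 2 P := hf.condExp (by norm_num)
  have h1 := hf.integrable_norm_pow (by norm_num)
  have h2 := hc.integrable_norm_pow (by norm_num)
  have h3 : ∫ ω, ‖(P[f | m]) ω‖ ^ 2 ∂P ≤ ∫ ω, ‖f ω‖ ^ 2 ∂P := by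
    have := integral_norm_condExp_rpow_le (p := 2) (m := m) (μ := P) (f := f) (by norm_num)
      (by simpa using h1)
    simpa using this
  calc ∫ ω, ‖condCenter m P f ω‖ ^ 2 ∂P
      ≤ ∫ ω, (2 * ‖f ω‖ ^ 2 + 2 * ‖(P[f | m]) ω‖ ^ 2) ∂P := by
        refine integral_mono ((hf.sub hc).integrable_norm_pow (by norm_num))
          ((h1.const_mul 2).add (h2.const_mul 2)) fun ω => ?_
        have := norm_sub_le (f ω) ((P[f | m]) ω)
        have h0 := norm_nonneg (f ω - (P[f | m]) ω)
        change ‖f ω - (P[f | m]) ω‖ ^ 2 ≤ _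
        nlinarith [sq_nonneg (‖f ω‖ - ‖(P[f | m]) ω‖)]
    _ = 2 * ∫ ω, ‖f ω‖ ^ 2 ∂P + 2 * ∫ ω, ‖(P[f | m]) ω‖ ^ 2 ∂P := by
        rw [integral_add (h1.const_mul 2) (h2.const_mul 2), integral_const_mul,
          integral_const_mul]
    _ ≤ _ := by linarith

theorem lintegral_enorm_condCenter_le {f : Ω → E}
    (hf : AEStronglyMeasurable f P) :
    ∫⁻ ω, ‖condCenter m P f ω‖ₑ ∂P ≤ 2 * ∫⁻ ω, ‖f ω‖ₑ ∂P := by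
  have h := eLpNorm_condExp_le_eLpNorm (μ := P) (m := m) f (p := 1) le_rfl
  rw [eLpNorm_one_eq_lintegral_enorm, eLpNorm_one_eq_lintegral_enorm] at h
  calc ∫⁻ ω, ‖condCenter m P f ω‖ₑ ∂P ≤ ∫⁻ ω, (‖f ω‖ₑ + ‖(P[f | m]) ω‖ₑ) ∂P :=
        lintegral_mono fun ω => enorm_sub_le
    _ = ∫⁻ ω, ‖f ω‖ₑ ∂P + ∫⁻ ω, ‖(P[f | m]) ω‖ₑ ∂P := lintegral_add_left' hf.enorm _
    _ ≤ _ := by rw [two_mul]; gcongr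

/-- The conditional expectations of the two parts add up to that of `d`, which vanishes, so centring
both parts changes nothing in total and keeps each a martingale difference. -/
theorem ae_eq_condCenter_smallPart_add_largePart [IsFiniteMeasure P] {d : Ω → E} (y : ℝ)
    (hd : Integrable d P) (hs : Integrable (smallPart y d) P) (hd0 : P[d | m] =ᵐ[P] 0) :
    d =ᵐ[P] condCenter m P (smallPart y d) + condCenter m P (largePart y d) := by
  have hl : Integrable (largePart y d) P := by
    have : largePart y d = d - smallPart y d := by
      rw [eq_sub_iff_add_eq, add_comm, smallPart_add_largePart]
    rw [this]; exact hd.sub hs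
  have h := condExp_add hs hl m
  rw [smallPart_add_largePart] at h
  filter_upwards [h, hd0] with ω h1 h2
  rw [h2] at h1
  have h3 := congrFun (smallPart_add_largePart y d) ω
  simp only [Pi.add_apply, Pi.zero_apply] at h1 h3
  simp only [condCenter, Pi.add_apply, Pi.sub_apply]
  rw [sub_add_sub_comm, ← h1, h3, sub_zero]

end Truncation

end EmpiricalProcess

/-! ### Maximal inequality for martingales with identically distributed norms -/

namespace EmpiricalProcess

/-- The constant of the maximal inequality `lintegral_iSup_norm_sum_le`. -/
noncomputable def maximalConst (p : ℝ) : ℝ :=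
  16 * (1 - 2 ^ ((p - 2) / p))⁻¹ + 4 * (2 ^ ((p - 1) / p) * (2 ^ ((p - 1) / p) - 1)⁻¹)

/-- The normalised maximal function `sup_n (n+1)^{-1/p} ‖D_0 + ⋯ + D_{n-1}‖`. -/
noncomputable def maximalFun {Ω E : Type*} [NormedAddCommGroup E] (p : ℝ) (D : ℕ → Ω → E)
    (ω : Ω) : ℝ≥0∞ :=
  ⨆ n : ℕ, ENNReal.ofReal (((n : ℝ) + 1) ^ (-(1 / p))) * ‖∑ i ∈ Finset.range n, D i ω‖ₑ

theorem measurable_enorm_sum {Ω E : Type*} {mΩ : MeasurableSpace Ω} [NormedAddCommGroup E]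
    (ℱ : Filtration ℕ mΩ) (D : ℕ → Ω → E) (hD : ∀ i, StronglyMeasurable[ℱ (i + 1)] (D i)) (n : ℕ) :
    Measurable fun ω => ‖∑ i ∈ Finset.range n, D i ω‖ₑ :=
  ((stronglyMeasurable_sum_range ℱ D hD n).mono (ℱ.le n)).enorm

section Maximal

variable {Ω E : Type*} {mΩ : MeasurableSpace Ω} {P : Measure Ω} [IsProbabilityMeasure P]
  [NormedAddCommGroup E] [InnerProductSpace ℝ E] [CompleteSpace E]
  (ℱ : Filtration ℕ mΩ) (D : ℕ → Ω → E)

/-- The maximum of the truncated martingale on a dyadic block. -/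
theorem measure_two_pow_lt_iSup_le {p : ℝ} (hp : 0 < p) {r : ℕ} {V : ℝ}
    (hD : ∀ i, StronglyMeasurable[ℱ (i + 1)] (D i))
    (hD0 : ∀ i, P[D i | ℱ i] =ᵐ[P] 0) (hD2 : ∀ i, MemLp (D i) 2 P)
    (hV : ∀ i, ∫ ω, ‖D i ω‖ ^ 2 ∂P ≤ V) (j : ℕ) :
    P {ω | 2 ^ j < ⨆ n ≤ 2 ^ (r + 1), ENNReal.ofReal (dyadicLevel p r)⁻¹
        * ‖∑ i ∈ Finset.range n, D i ω‖ₑ}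
      ≤ ENNReal.ofReal (2 * (dyadicLevel p r ^ (p - 2) * V)) * (4 ^ j)⁻¹ := by
  set y := dyadicLevel p r with hy
  have hy0 : 0 < y := dyadicLevel_pos p r
  have hsub : {ω | 2 ^ j < ⨆ n ≤ 2 ^ (r + 1), ENNReal.ofReal y⁻¹
        * ‖∑ i ∈ Finset.range n, D i ω‖ₑ}
      ⊆ {ω | ∃ n ≤ 2 ^ (r + 1), 2 ^ j * y ≤ ‖∑ i ∈ Finset.range n, D i ω‖} := by
    intro ω hω
    simp only [Set.mem_ofPred_eq, lt_iSup_iff] at hω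
    obtain ⟨n, hn, h⟩ := hω
    refine ⟨n, hn, ?_⟩
    rw [← ofReal_norm, ← ENNReal.ofReal_mul (by positivity),
      show (2 : ℝ≥0∞) ^ j = ENNReal.ofReal (2 ^ j) by
        rw [ENNReal.ofReal_pow (by norm_num)]; simp,
      ENNReal.ofReal_lt_ofReal_iff_of_nonneg (by positivity), inv_mul_eq_div,
      lt_div_iff₀ hy0] at h
    exact h.le
  refine (measure_mono hsub).trans
    ((measure_exists_norm_sum_ge_le ℱ D hD hD0 hD2 (by positivity) _).trans ?_)
  have e4 : ((4 : ℝ≥0∞) ^ j)⁻¹ = ENNReal.ofReal ((4 ^ j)⁻¹) := by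
    rw [ENNReal.ofReal_inv_of_pos (by positivity), ENNReal.ofReal_pow (by norm_num)]; simp
  have hV0 : 0 ≤ V := (integral_nonneg fun ω => sq_nonneg _).trans (hV 0)
  rw [e4, ← ENNReal.ofReal_mul (by positivity)]
  refine ENNReal.ofReal_le_ofReal ?_
  have hs : ∑ i ∈ Finset.range (2 ^ (r + 1)), ∫ ω, ‖D i ω‖ ^ 2 ∂P ≤ 2 ^ (r + 1) * V := by
    refine (Finset.sum_le_card_nsmul _ _ V fun i _ => hV i).trans (le_of_eq ?_)
    simp
  -- The defining property `y ^ p = 2 ^ r` of the level trades the block length for a power of `y`.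
  have hyp : y ^ (p - 2) * y ^ 2 = 2 ^ r := by
    rw [← Real.rpow_natCast, ← Real.rpow_add hy0, ← dyadicLevel_rpow hp.ne']
    norm_num [hy]
  rw [div_le_iff₀ (by positivity)]
  refine hs.trans (le_of_eq ?_)
  rw [mul_pow, pow_succ, ← hyp, ← pow_mul, mul_comm j 2, pow_mul]
  have : ((2 : ℝ) ^ 2) ^ j = 4 ^ j := by norm_num
  rw [this]
  field_simp

/-- On the block `2^r ≤ n + 1 < 2^(r+1)` the increments are truncated at `2^(r/p)`. The truncated
martingales satisfy weak `L²` bounds, which sum over the blocks to a moment of order `p`; the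
remainders are summed crudely in `L¹`. The bound is not homogeneous in `D`, which is repaired by
scaling in `lintegral_maximalFun_le`. -/
theorem lintegral_iSup_norm_sum_le {p : ℝ} (hp1 : 1 < p) (hp2 : p < 2)
    (hD : ∀ i, StronglyMeasurable[ℱ (i + 1)] (D i))
    (hD0 : ∀ i, P[D i | ℱ i] =ᵐ[P] 0)
    (hid : ∀ i, IdentDistrib (fun ω => ‖D i ω‖) (fun ω => ‖D 0 ω‖) P P)
    (hDp : MemLp (D 0) (ENNReal.ofReal p) P) :
    ∫⁻ ω, maximalFun p D ω ∂P
      ≤ 1 + ENNReal.ofReal (maximalConst p * ∫ ω, ‖D 0 ω‖ ^ p ∂P) := by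
  have hp0 : 0 < p := by linarith
  have hDm : ∀ i, StronglyMeasurable (D i) := fun i => (hD i).mono (ℱ.le _)
  have hDint : ∀ i, Integrable (D i) P := by
    intro i
    have h0 : Integrable (D 0) P := hDp.integrable (by
      rw [← ENNReal.ofReal_one]; exact ENNReal.ofReal_le_ofReal hp1.le)
    have := (hid i).symm.integrable_snd h0.norm
    exact (integrable_norm_iff (hDm i).aestronglyMeasurable).1 this
  set y := dyadicLevel p with hy
  have hy0 : ∀ r, 0 < y r := dyadicLevel_pos p
  set S : ℕ → ℕ → Ω → E := fun r i => condCenter (ℱ i) P (smallPart (y r) (D i)) with hS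
  set B : ℕ → ℕ → Ω → E := fun r i => condCenter (ℱ i) P (largePart (y r) (D i)) with hB
  have hsm : ∀ r i, StronglyMeasurable[ℱ (i + 1)] (smallPart (y r) (D i)) := fun r i =>
    stronglyMeasurable_smallPart (hD i) _
  have hlm : ∀ r i, StronglyMeasurable[ℱ (i + 1)] (largePart (y r) (D i)) := fun r i =>
    stronglyMeasurable_largePart (hD i) _
  have hcond : ∀ i, ∀ f : Ω → E, StronglyMeasurable[ℱ (i + 1)] (P[f | ℱ i]) := fun i f =>
    stronglyMeasurable_condExp.mono (ℱ.mono (Nat.le_succ i))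
  have hSm : ∀ r i, StronglyMeasurable[ℱ (i + 1)] (S r i) := fun r i => (hsm r i).sub (hcond i _)
  have hBm : ∀ r i, StronglyMeasurable[ℱ (i + 1)] (B r i) := fun r i => (hlm r i).sub (hcond i _)
  have hs2 : ∀ r i, MemLp (smallPart (y r) (D i)) 2 P := fun r i =>
    MemLp.of_bound ((hsm r i).mono (ℱ.le _)).aestronglyMeasurable (y r)
      (ae_of_all _ fun ω => norm_smallPart_le (hy0 r).le _ ω)
  have hS2 : ∀ r i, MemLp (S r i) 2 P := fun r i => (hs2 r i).sub ((hs2 r i).condExp (by norm_num))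
  have hS0 : ∀ r i, P[S r i | ℱ i] =ᵐ[P] 0 := fun r i =>
    condExp_condCenter (ℱ.le i) ((hs2 r i).integrable (by norm_num))
  have hsplit : ∀ r i, D i =ᵐ[P] S r i + B r i := by
    exact fun r i => ae_eq_condCenter_smallPart_add_largePart (y r) (hDint i)
      ((hs2 r i).integrable (by norm_num)) (hD0 i)
  -- the second moments of the truncated differences
  have hVs : ∀ r i, ∫ ω, ‖S r i ω‖ ^ 2 ∂P ≤ 4 * ∫ ω, ‖smallPart (y r) (D 0) ω‖ ^ 2 ∂P := by
    intro r i
    refine (integral_sq_norm_condCenter_le (hs2 r i)).trans (le_of_eq ?_)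
    have hφ : Measurable fun x : ℝ => if x ≤ y r then x ^ 2 else 0 :=
      Measurable.ite measurableSet_Iic (measurable_id.pow_const 2) measurable_const
    have := ((hid i).comp hφ).integral_eq
    simp only [Function.comp_def] at this
    simp_rw [sq_norm_smallPart]
    rw [this]
  have hBi : ∀ r i, ∫⁻ ω, ‖B r i ω‖ₑ ∂P ≤ 2 * ∫⁻ ω, ‖largePart (y r) (D 0) ω‖ₑ ∂P := by
    intro r i
    refine (lintegral_enorm_condCenter_le
      ((hlm r i).mono (ℱ.le _)).aestronglyMeasurable).trans (le_of_eq ?_)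
    have hφ : Measurable fun x : ℝ => ENNReal.ofReal (if y r < x then x else 0) :=
      (Measurable.ite measurableSet_Ioi measurable_id measurable_const).ennreal_ofReal
    have := ((hid i).comp hφ).lintegral_eq
    simp only [Function.comp_def] at this
    simp_rw [← ofReal_norm, norm_largePart]
    rw [this]
  set U : ℕ → Ω → ℝ≥0∞ := fun r ω => ⨆ n ≤ 2 ^ (r + 1), ENNReal.ofReal (y r)⁻¹
        * ‖∑ i ∈ Finset.range n, S r i ω‖ₑ with hU
  have hUm : ∀ r, Measurable (U r) := fun r => Measurable.iSup fun n => Measurable.iSup fun _ =>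
    (measurable_enorm_sum ℱ (S r) (hSm r) n).const_mul _
  set V : Ω → ℝ≥0∞ := fun ω => ∑' r, ENNReal.ofReal (y r)⁻¹
        * ∑ i ∈ Finset.range (2 ^ (r + 1)), ‖B r i ω‖ₑ with hV
  have hBme : ∀ r i, Measurable fun ω => ‖B r i ω‖ₑ := fun r i => ((hBm r i).mono (ℱ.le _)).enorm
  have hVm : Measurable V := Measurable.tsum fun r =>
    (Finset.measurable_fun_sum _ fun i _ => hBme r i).const_mul _
  have hpt : ∀ᵐ ω ∂P, maximalFun p D ω ≤ (⨆ r, U r ω) + V ω := by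
    have : ∀ᵐ ω ∂P, ∀ r i, D i ω = S r i ω + B r i ω :=
      ae_all_iff.2 fun r => ae_all_iff.2 fun i => hsplit r i
    filter_upwards [this] with ω hω
    refine iSup_le fun n => ?_
    -- Using `n + 1` places `n = 0` in the block `r = 0`, and matches the normalisation in
    -- `maximalFun`.
    set r := Nat.log 2 (n + 1) with hr
    have hlo : 2 ^ r ≤ n + 1 := Nat.pow_log_le_self 2 (Nat.succ_ne_zero n)
    have hhi : n + 1 < 2 ^ (r + 1) := Nat.lt_pow_succ_log_self (by norm_num) _
    have hw : ((n : ℝ) + 1) ^ (-(1 / p)) ≤ (y r)⁻¹ := by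
      have h1 : y r = ((2 : ℝ) ^ r) ^ (1 / p) := by
        rw [hy, dyadicLevel, ← Real.rpow_natCast, ← Real.rpow_mul two_pos.le]
        congr 1; ring
      rw [Real.rpow_neg (by positivity), h1]
      gcongr
      exact_mod_cast hlo
    calc ENNReal.ofReal (((n : ℝ) + 1) ^ (-(1 / p))) * ‖∑ i ∈ Finset.range n, D i ω‖ₑ
        ≤ ENNReal.ofReal (y r)⁻¹ * (‖∑ i ∈ Finset.range n, S r i ω‖ₑ
          + ∑ i ∈ Finset.range (2 ^ (r + 1)), ‖B r i ω‖ₑ) := by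
          gcongr
          simp_rw [hω r, Finset.sum_add_distrib]
          refine (enorm_add_le _ _).trans (add_le_add_right ?_ _)
          refine (enorm_sum_le _ _).trans (Finset.sum_le_sum_of_subset ?_)
          exact Finset.range_mono (by omega)
      _ ≤ (⨆ r, U r ω) + V ω := by
          rw [mul_add]
          gcongr
          · refine le_trans ?_ (le_iSup (fun r => U r ω) r)
            exact le_iSup₂_of_le (f := fun n (_ : n ≤ 2 ^ (r + 1)) => ENNReal.ofReal (y r)⁻¹
              * ‖∑ i ∈ Finset.range n, S r i ω‖ₑ) n (by omega) le_rfl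
          · exact ENNReal.le_tsum (f := fun r => ENNReal.ofReal (y r)⁻¹
              * ∑ i ∈ Finset.range (2 ^ (r + 1)), ‖B r i ω‖ₑ) r
  have hDpi := hDp.integrable_norm_rpow_ofReal hp0
  have hD0m : Measurable fun ω => ‖D 0 ω‖ := (hDm 0).norm.measurable
  set I := ∫ ω, ‖D 0 ω‖ ^ p ∂P with hI
  have hIlin : ∀ c : ℝ, 0 ≤ c → ∫⁻ ω, ENNReal.ofReal (c * ‖D 0 ω‖ ^ p) ∂P
      = ENNReal.ofReal (c * I) := by
    intro c hc
    rw [← ofReal_integral_eq_lintegral_ofReal (hDpi.const_mul c)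
      (ae_of_all _ fun ω => by positivity), integral_const_mul]
  set K₁ := (1 - (2 : ℝ) ^ ((p - 2) / p))⁻¹ with hK₁
  set K₂ := (2 : ℝ) ^ ((p - 1) / p) * (2 ^ ((p - 1) / p) - 1)⁻¹ with hK₂
  have hK₁0 : 0 ≤ K₁ := inv_nonneg.2 (sub_nonneg.2 (Real.rpow_le_one_of_one_le_of_nonpos
    (by norm_num) (div_nonpos_of_nonpos_of_nonneg (by linarith) (by linarith))))
  have hK₂0 : 0 ≤ K₂ := mul_nonneg (by positivity) (inv_nonneg.2 (sub_nonneg.2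
    (Real.one_le_rpow (by norm_num) (div_nonneg (by linarith) (by linarith)))))
  -- The 16 is 2 from the weak-type lemma, 2 from the block length `2^(r+1)`, and 4 from centring in
  -- `L²`.
  have hUle : ∫⁻ ω, ⨆ r, U r ω ∂P ≤ 1 + ENNReal.ofReal (16 * K₁ * I) := by
    refine (lintegral_iSup_le_of_weak hUm fun r j => measure_two_pow_lt_iSup_le ℱ (S r) hp0
      (hSm r) (hS0 r) (hS2 r) (hVs r) j).trans ?_
    gcongr
    have hb : ∀ r, ENNReal.ofReal (2 * (dyadicLevel p r ^ (p - 2)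
          * (4 * ∫ ω, ‖smallPart (y r) (D 0) ω‖ ^ 2 ∂P)))
        = ∫⁻ ω, ENNReal.ofReal (8 * (y r ^ (p - 2)
          * (if ‖D 0 ω‖ ≤ y r then ‖D 0 ω‖ ^ 2 else 0))) ∂P := by
      intro r
      have hi := (hs2 r 0).integrable_norm_pow (by norm_num)
      simp only [sq_norm_smallPart] at hi ⊢
      rw [← ofReal_integral_eq_lintegral_ofReal ((hi.const_mul _).const_mul _)
        (ae_of_all _ fun ω => ?_), integral_const_mul, integral_const_mul]
      · congr 1; ring
      · have := (hy0 r).le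
        dsimp only
        positivity
    simp_rw [hb]
    have hm : ∀ r, Measurable fun ω => ENNReal.ofReal (8 * (y r ^ (p - 2)
        * (if ‖D 0 ω‖ ≤ y r then ‖D 0 ω‖ ^ 2 else 0))) := fun r =>
      (((Measurable.ite (hD0m measurableSet_Iic) (hD0m.pow_const 2)
        measurable_const).const_mul _).const_mul _).ennreal_ofReal
    rw [← lintegral_tsum fun r => (hm r).aemeasurable]
    calc 2 * ∫⁻ ω, ∑' r, ENNReal.ofReal (8 * (y r ^ (p - 2)
          * (if ‖D 0 ω‖ ≤ y r then ‖D 0 ω‖ ^ 2 else 0))) ∂P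
        ≤ 2 * ∫⁻ ω, ENNReal.ofReal (8 * K₁ * ‖D 0 ω‖ ^ p) ∂P := by
          gcongr with ω
          refine ENNReal.tsum_le_of_sum_range_le fun R => ?_
          rw [← ENNReal.ofReal_sum_of_nonneg fun r _ => by have := (hy0 r).le; positivity]
          refine ENNReal.ofReal_le_ofReal ?_
          rw [← Finset.mul_sum, mul_assoc]
          exact mul_le_mul_of_nonneg_left
            (sum_dyadicLevel_small_le hp1 hp2 (norm_nonneg _) R) (by norm_num)
      _ = ENNReal.ofReal (16 * K₁ * I) := by
          rw [hIlin _ (by positivity), show (2 : ℝ≥0∞) = ENNReal.ofReal 2 by simp,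
            ← ENNReal.ofReal_mul (by norm_num)]
          congr 1; ring
  -- The 4 is 2 from the block length and 2 from centring in `L¹`.
  have hVle : ∫⁻ ω, V ω ∂P ≤ ENNReal.ofReal (4 * K₂ * I) := by
    rw [hV, lintegral_tsum fun r =>
      ((Finset.measurable_fun_sum _ fun i _ => hBme r i).const_mul _).aemeasurable]
    have hb : ∀ r, ∫⁻ ω, ENNReal.ofReal (y r)⁻¹
          * ∑ i ∈ Finset.range (2 ^ (r + 1)), ‖B r i ω‖ₑ ∂P
        ≤ ∫⁻ ω, ENNReal.ofReal (4 * (y r ^ (p - 1)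
          * (if y r < ‖D 0 ω‖ then ‖D 0 ω‖ else 0))) ∂P := by
      intro r
      rw [lintegral_const_mul _ (Finset.measurable_fun_sum _ fun i _ => hBme r i),
        lintegral_finsetSum _ fun i _ => hBme r i]
      have h1 : ∑ i ∈ Finset.range (2 ^ (r + 1)), ∫⁻ ω, ‖B r i ω‖ₑ ∂P
          ≤ 2 ^ (r + 1) * (2 * ∫⁻ ω, ‖largePart (y r) (D 0) ω‖ₑ ∂P) := by
        refine (Finset.sum_le_card_nsmul _ _ _ fun i _ => hBi r i).trans (le_of_eq ?_)
        simp
      have h2 : ∀ ω, ENNReal.ofReal (4 * (y r ^ (p - 1)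
          * (if y r < ‖D 0 ω‖ then ‖D 0 ω‖ else 0)))
          = ENNReal.ofReal (4 * y r ^ (p - 1)) * ‖largePart (y r) (D 0) ω‖ₑ := by
        intro ω
        rw [← ofReal_norm, norm_largePart, ← ENNReal.ofReal_mul
          (by have := (hy0 r).le; positivity), mul_assoc]
      simp_rw [h2]
      rw [lintegral_const_mul _ ((hlm r 0).mono (ℱ.le _)).enorm]
      calc _ ≤ ENNReal.ofReal (y r)⁻¹
            * (2 ^ (r + 1) * (2 * ∫⁻ ω, ‖largePart (y r) (D 0) ω‖ₑ ∂P)) := by gcongr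
        _ = _ := by
            rw [← mul_assoc, ← mul_assoc]
            congr 1
            have e : (2 : ℝ≥0∞) = ENNReal.ofReal 2 := by simp
            rw [e, ← ENNReal.ofReal_pow (by norm_num), ← ENNReal.ofReal_mul
              (inv_nonneg.2 (hy0 r).le), ← ENNReal.ofReal_mul
              (mul_nonneg (inv_nonneg.2 (hy0 r).le) (by positivity))]
            congr 1
            rw [pow_succ, ← dyadicLevel_rpow hp0.ne', Real.rpow_sub_one (hy0 r).ne']
            ring
    refine (ENNReal.tsum_le_tsum hb).trans ?_
    have hm : ∀ r, Measurable fun ω => ENNReal.ofReal (4 * (y r ^ (p - 1)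
        * (if y r < ‖D 0 ω‖ then ‖D 0 ω‖ else 0))) := fun r =>
      (((Measurable.ite (hD0m measurableSet_Ioi) hD0m
        measurable_const).const_mul _).const_mul _).ennreal_ofReal
    rw [← lintegral_tsum fun r => (hm r).aemeasurable]
    rw [← hIlin _ (by positivity)]
    refine lintegral_mono fun ω => ENNReal.tsum_le_of_sum_range_le fun R => ?_
    rw [← ENNReal.ofReal_sum_of_nonneg fun r _ => by have := (hy0 r).le; positivity]
    refine ENNReal.ofReal_le_ofReal ?_
    rw [← Finset.mul_sum, mul_assoc]
    exact mul_le_mul_of_nonneg_left (sum_dyadicLevel_large_le hp1 (norm_nonneg _) R) (by norm_num)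
  have hI0 : 0 ≤ I := integral_nonneg fun ω => by positivity
  calc ∫⁻ ω, maximalFun p D ω ∂P ≤ ∫⁻ ω, ((⨆ r, U r ω) + V ω) ∂P := lintegral_mono_ae hpt
    _ = ∫⁻ ω, (⨆ r, U r ω) ∂P + ∫⁻ ω, V ω ∂P := lintegral_add_right _ hVm
    _ ≤ (1 + ENNReal.ofReal (16 * K₁ * I)) + ENNReal.ofReal (4 * K₂ * I) := add_le_add hUle hVle
    _ = 1 + ENNReal.ofReal (maximalConst p * I) := by
        rw [add_assoc, ← ENNReal.ofReal_add (by positivity) (by positivity), ← add_mul]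
        rfl

end Maximal

end EmpiricalProcess

/-! ### Homogeneous maximal inequality and transfer to stationary increments -/

namespace EmpiricalProcess

section Scaling

variable {Ω E : Type*} {mΩ : MeasurableSpace Ω} {P : Measure Ω} [IsProbabilityMeasure P]
  [NormedAddCommGroup E] [InnerProductSpace ℝ E] [CompleteSpace E]
  (ℱ : Filtration ℕ mΩ) (D : ℕ → Ω → E)

theorem maximalConst_nonneg {p : ℝ} (hp1 : 1 < p) (hp2 : p < 2) : 0 ≤ maximalConst p := by
  have h1 : 0 ≤ (1 - (2 : ℝ) ^ ((p - 2) / p))⁻¹ :=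
    inv_nonneg.2 (sub_nonneg.2 (Real.rpow_le_one_of_one_le_of_nonpos
      (by norm_num) (div_nonpos_of_nonpos_of_nonneg (by linarith) (by linarith))))
  have h2 : 0 ≤ ((2 : ℝ) ^ ((p - 1) / p) - 1)⁻¹ := inv_nonneg.2 (sub_nonneg.2
    (Real.one_le_rpow (by norm_num) (div_nonneg (by linarith) (by linarith))))
  rw [maximalConst]
  positivity

/-- The scale invariant maximal inequality. -/
theorem lintegral_maximalFun_le {p : ℝ} (hp1 : 1 < p) (hp2 : p < 2)
    (hD : ∀ i, StronglyMeasurable[ℱ (i + 1)] (D i))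
    (hD0 : ∀ i, P[D i | ℱ i] =ᵐ[P] 0)
    (hid : ∀ i, IdentDistrib (fun ω => ‖D i ω‖) (fun ω => ‖D 0 ω‖) P P)
    (hDp : MemLp (D 0) (ENNReal.ofReal p) P) :
    ∫⁻ ω, maximalFun p D ω ∂P
      ≤ ENNReal.ofReal ((1 + maximalConst p) * lpNorm (D 0) (ENNReal.ofReal p) P) := by
  have hp0 : 0 < p := by linarith
  have hK := maximalConst_nonneg hp1 hp2
  set L := lpNorm (D 0) (ENNReal.ofReal p) P with hL
  have hL0 : 0 ≤ L := lpNorm_nonneg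
  -- Dividing by `s > L` brings the moment of order `p` below 1. Taking `s` strictly larger, then `s
  -- → L`, avoids a separate case `L = 0`.
  have key : ∀ s : ℝ, L < s → ∫⁻ ω, maximalFun p D ω ∂P
      ≤ ENNReal.ofReal ((1 + maximalConst p) * s) := by
    intro s hs
    have hs0 : 0 < s := hL0.trans_lt hs
    have hcs : ∀ i ω, ‖(s⁻¹ • D i) ω‖ = s⁻¹ * ‖D i ω‖ := fun i ω => by
      rw [Pi.smul_apply, norm_smul, Real.norm_of_nonneg (inv_nonneg.2 hs0.le)]
    have h := lintegral_iSup_norm_sum_le ℱ (fun i => s⁻¹ • D i) hp1 hp2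
      (fun i => (hD i).const_smul _) (fun i => by
        refine (condExp_smul s⁻¹ (D i) (ℱ i)).trans ?_
        filter_upwards [hD0 i] with ω hω
        simp [hω]) (fun i => by
        simp only [hcs]
        exact (hid i).comp (measurable_const_mul s⁻¹)) (hDp.const_smul s⁻¹)
    have hmax : ∀ ω, maximalFun p (fun i => s⁻¹ • D i) ω
        = ENNReal.ofReal s⁻¹ * maximalFun p D ω := by
      intro ω
      rw [maximalFun, maximalFun, ENNReal.mul_iSup]
      refine iSup_congr fun n => ?_
      have : ∑ i ∈ Finset.range n, (s⁻¹ • D i) ω = s⁻¹ • ∑ i ∈ Finset.range n, D i ω := by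
        rw [Finset.smul_sum]; rfl
      rw [this, enorm_smul, mul_left_comm, Real.enorm_of_nonneg (inv_nonneg.2 hs0.le)]
    have hm : Measurable (maximalFun p D) := Measurable.iSup fun n =>
      (measurable_enorm_sum ℱ D hD n).const_mul _
    simp_rw [hmax] at h
    rw [lintegral_const_mul _ hm] at h
    have hI : ∫ ω, ‖(s⁻¹ • D 0) ω‖ ^ p ∂P ≤ 1 := by
      have e : ∀ ω, ‖(s⁻¹ • D 0) ω‖ ^ p = (s⁻¹) ^ p * ‖D 0 ω‖ ^ p := fun ω => by
        rw [hcs, Real.mul_rpow (inv_nonneg.2 hs0.le) (norm_nonneg _)]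
      simp_rw [e]
      rw [integral_const_mul, ← lpNorm_ofReal_rpow hp0 hDp.1, ← hL,
        ← Real.mul_rpow (inv_nonneg.2 hs0.le) hL0]
      refine Real.rpow_le_one (by positivity) ?_ hp0.le
      rw [inv_mul_eq_div, div_le_one hs0]
      exact hs.le
    have h2 : ENNReal.ofReal s⁻¹ * ∫⁻ ω, maximalFun p D ω ∂P
        ≤ ENNReal.ofReal (1 + maximalConst p) := by
      refine h.trans ?_
      rw [ENNReal.ofReal_add (by norm_num) hK, ENNReal.ofReal_one]
      gcongr
      exact mul_le_of_le_one_right hK hI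
    calc ∫⁻ ω, maximalFun p D ω ∂P
        = ENNReal.ofReal s * (ENNReal.ofReal s⁻¹ * ∫⁻ ω, maximalFun p D ω ∂P) := by
          rw [← mul_assoc, ← ENNReal.ofReal_mul hs0.le, mul_inv_cancel₀ hs0.ne',
            ENNReal.ofReal_one, one_mul]
      _ ≤ ENNReal.ofReal s * ENNReal.ofReal (1 + maximalConst p) := by gcongr
      _ = _ := by rw [← ENNReal.ofReal_mul hs0.le, mul_comm]
  have hc : Tendsto (fun s : ℝ => ENNReal.ofReal ((1 + maximalConst p) * s))
      (nhdsWithin L (Set.Ioi L)) (nhds (ENNReal.ofReal ((1 + maximalConst p) * L))) :=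
    ((ENNReal.continuous_ofReal.comp (continuous_const.mul continuous_id)).tendsto L).mono_left
      nhdsWithin_le_nhds
  exact ge_of_tendsto hc (eventually_nhdsWithin_of_forall key)

end Scaling

section Stationary

theorem identDistrib_comp_measurePreserving {Ω F : Type*} {mΩ : MeasurableSpace Ω}
    [MeasurableSpace F] {P : Measure Ω} {φ : Ω → Ω}
    (hφ : MeasurePreserving φ P P) {f : Ω → F} (hf : Measurable f) :
    IdentDistrib (f ∘ φ) f P P where
  aemeasurable_fst := (hf.comp hφ.measurable).aemeasurable
  aemeasurable_snd := hf.aemeasurable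
  map_eq := by rw [← Measure.map_map hf hφ.measurable, hφ.map_eq]

/-- Conditional expectations commute with measure preserving maps. -/
theorem condExp_comp_measurePreserving {Ω E : Type*} {m mΩ : MeasurableSpace Ω} {P : Measure Ω}
    [IsProbabilityMeasure P] [NormedAddCommGroup E] [NormedSpace ℝ E] [CompleteSpace E]
    {φ : Ω → Ω} (hφ : MeasurePreserving φ P P) (hm : m ≤ mΩ) {f : Ω → E} (hf : Integrable f P) :
    P[f ∘ φ | m.comap φ] =ᵐ[P] P[f | m] ∘ φ := by
  have hle : m.comap φ ≤ mΩ := (MeasurableSpace.comap_mono hm).trans hφ.measurable.comap_le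
  have hsm : StronglyMeasurable[m.comap φ] (P[f | m] ∘ φ) :=
    stronglyMeasurable_condExp.comp_measurable (comap_measurable φ)
  have hint : Integrable (P[f | m] ∘ φ) P := hφ.integrable_comp_of_integrable integrable_condExp
  symm
  refine ae_eq_condExp_of_forall_setIntegral_eq hle (hφ.integrable_comp_of_integrable hf)
    (fun s _ _ => hint.integrableOn) ?_ hsm.aestronglyMeasurable
  rintro s ⟨t, ht, rfl⟩ -
  have key : ∀ g : Ω → E, Integrable g P → ∫ ω in φ ⁻¹' t, (g ∘ φ) ω ∂P = ∫ ω in t, g ω ∂P := by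
    intro g hg
    have := setIntegral_map (μ := P) (g := φ) (f := g) (hm _ ht)
      (by rw [hφ.map_eq]; exact hg.1) hφ.measurable.aemeasurable
    rw [hφ.map_eq] at this
    exact this.symm
  rw [key _ integrable_condExp, key _ hf, setIntegral_condExp hm hf ht]

variable {Ω E : Type*} {G mΩ : MeasurableSpace Ω} {P : Measure Ω} [IsProbabilityMeasure P]
  {θ : Ω → Ω}

theorem comap_iterate_le_succ (hGθ : G ≤ G.comap θ) (n : ℕ) :
    G.comap θ^[n] ≤ G.comap θ^[n + 1] := by
  have : G.comap θ^[n + 1] = (G.comap θ).comap θ^[n] := by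
    rw [MeasurableSpace.comap_comp, Function.iterate_succ']
  rw [this]
  exact MeasurableSpace.comap_mono hGθ

/-- The filtration `θ^{-n} G` generated by an invariant σ-algebra. -/
def comapFiltration (hG : G ≤ mΩ) (hGθ : G ≤ G.comap θ) (hθ : Measurable θ) :
    Filtration ℕ mΩ where
  seq n := G.comap θ^[n]
  mono' := monotone_nat_of_le_succ (comap_iterate_le_succ hGθ)
  le' n := (MeasurableSpace.comap_mono hG).trans (hθ.iterate n).comap_le

variable [NormedAddCommGroup E] [InnerProductSpace ℝ E] [CompleteSpace E]

/-- The maximal inequality for stationary martingale differences. -/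
theorem lintegral_maximalFun_iterate_le {p : ℝ} (hp1 : 1 < p) (hp2 : p < 2)
    (hG : G ≤ mΩ) (hGθ : G ≤ G.comap θ) (hθ : MeasurePreserving θ P P) {d : Ω → E}
    (hd : StronglyMeasurable[G.comap θ] d) (hd0 : P[d | G] =ᵐ[P] 0)
    (hdp : MemLp d (ENNReal.ofReal p) P) :
    ∫⁻ ω, maximalFun p (fun i => d ∘ θ^[i]) ω ∂P
      ≤ ENNReal.ofReal ((1 + maximalConst p) * lpNorm d (ENNReal.ofReal p) P) := by
  have hdi : Integrable d P := hdp.integrable (by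
    rw [← ENNReal.ofReal_one]; exact ENNReal.ofReal_le_ofReal hp1.le)
  have hdm : StronglyMeasurable d :=
    hd.mono ((MeasurableSpace.comap_mono hG).trans hθ.measurable.comap_le)
  refine lintegral_maximalFun_le (comapFiltration hG hGθ hθ.measurable) (fun i => d ∘ θ^[i])
    hp1 hp2 (fun i => ?_) (fun i => ?_) (fun i => ?_) hdp
  · have : comapFiltration hG hGθ hθ.measurable (i + 1) = (G.comap θ).comap θ^[i] := by
      rw [MeasurableSpace.comap_comp, ← Function.iterate_succ']; rfl
    rw [this]
    exact hd.comp_measurable (comap_measurable _)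
  · refine (condExp_comp_measurePreserving (hθ.iterate i) hG hdi).trans ?_
    exact (hθ.iterate i).quasiMeasurePreserving.ae_eq_comp hd0
  · exact identDistrib_comp_measurePreserving (hθ.iterate i) hdm.norm.measurable

end Stationary

end EmpiricalProcess

/-! ### Strong law for stationary martingales -/

namespace EmpiricalProcess

section StationaryMartingale

theorem term_le_maximalFun {Ω E : Type*} [NormedAddCommGroup E] (p : ℝ) (D : ℕ → Ω → E) (n : ℕ)
    (ω : Ω) : ENNReal.ofReal (((n : ℝ) + 1) ^ (-(1 / p))) * ‖∑ i ∈ Finset.range n, D i ω‖ₑ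
      ≤ maximalFun p D ω :=
  le_iSup (fun n : ℕ => ENNReal.ofReal (((n : ℝ) + 1) ^ (-(1 / p)))
    * ‖∑ i ∈ Finset.range n, D i ω‖ₑ) n

theorem measurable_maximalFun_iterate {Ω E : Type*} {mΩ : MeasurableSpace Ω}
    [NormedAddCommGroup E] {θ : Ω → Ω} (hθ : Measurable θ) {d : Ω → E}
    (hd : StronglyMeasurable d) (p : ℝ) : Measurable (maximalFun p fun i => d ∘ θ^[i]) :=
  Measurable.iSup fun _ => (StronglyMeasurable.enorm (Finset.stronglyMeasurable_fun_sum _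
    fun i _ => hd.comp_measurable (hθ.iterate i))).const_mul _

variable {Ω E : Type*} {G mΩ : MeasurableSpace Ω} {P : Measure Ω} [IsProbabilityMeasure P]
  {θ : Ω → Ω} [NormedAddCommGroup E] [InnerProductSpace ℝ E] [CompleteSpace E]

/-- A stationary martingale with increments in `L^q` satisfies `M_n = o(n^{1/p})` for `p < q`. -/
theorem tendsto_martingale_of_lt {p q : ℝ} (hp1 : 1 < p) (hpq : p < q) (hq2 : q < 2)
    (hG : G ≤ mΩ) (hGθ : G ≤ G.comap θ) (hθ : MeasurePreserving θ P P) {d : Ω → E}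
    (hd : StronglyMeasurable[G.comap θ] d) (hd0 : P[d | G] =ᵐ[P] 0)
    (hdq : MemLp d (ENNReal.ofReal q) P) :
    ∀ᵐ ω ∂P, Tendsto (fun n : ℕ => ENNReal.ofReal (((n : ℝ) + 1) ^ (-(1 / p)))
      * ‖∑ i ∈ Finset.range n, (d ∘ θ^[i]) ω‖ₑ) atTop (nhds 0) := by
  have hdm : StronglyMeasurable d :=
    hd.mono ((MeasurableSpace.comap_mono hG).trans hθ.measurable.comap_le)
  have h := lintegral_maximalFun_iterate_le (hp1.trans hpq) hq2 hG hGθ hθ hd hd0 hdq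
  have hfin := ae_lt_top (measurable_maximalFun_iterate hθ.measurable hdm q)
    (h.trans_lt ENNReal.ofReal_lt_top).ne
  filter_upwards [hfin] with ω hω
  have hp0 : 0 < p := by linarith
  have hlt : 1 / q < 1 / p := one_div_lt_one_div_of_lt hp0 hpq
  -- The maximal function of exponent `q` is finite almost surely, so `‖M_n‖` is of order `n^(1/q)`;
  -- the surplus `n^(1/q - 1/p)` tends to zero.
  have hw : Tendsto (fun n : ℕ => ENNReal.ofReal (((n : ℝ) + 1) ^ (-(1 / p - 1 / q))))
      atTop (nhds 0) := by
    have h1 : Tendsto (fun n : ℕ => (n : ℝ) + 1) atTop atTop :=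
      tendsto_atTop_add_const_right _ _ tendsto_natCast_atTop_atTop
    have h2 := (tendsto_rpow_neg_atTop (sub_pos.2 hlt)).comp h1
    have h3 := ENNReal.tendsto_ofReal h2
    rwa [ENNReal.ofReal_zero] at h3
  have h0 := ENNReal.Tendsto.mul_const (b := maximalFun q (fun i => d ∘ θ^[i]) ω) hw
    (Or.inr hω.ne)
  rw [zero_mul] at h0
  refine tendsto_of_tendsto_of_tendsto_of_le_of_le tendsto_const_nhds h0
    (fun n => zero_le) fun n => ?_
  have e : ENNReal.ofReal (((n : ℝ) + 1) ^ (-(1 / p)))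
      = ENNReal.ofReal (((n : ℝ) + 1) ^ (-(1 / p - 1 / q)))
        * ENNReal.ofReal (((n : ℝ) + 1) ^ (-(1 / q))) := by
    rw [← ENNReal.ofReal_mul (by positivity), ← Real.rpow_add (by positivity)]
    congr 2; ring
  dsimp only
  rw [e, mul_assoc]
  gcongr
  exact term_le_maximalFun q (fun i => d ∘ θ^[i]) n ω

/-- The Marcinkiewicz-Zygmund strong law for stationary Hilbert space valued martingales. -/
theorem tendsto_martingale {p : ℝ} (hp1 : 1 < p) (hp2 : p < 2)
    (hG : G ≤ mΩ) (hGθ : G ≤ G.comap θ) (hθ : MeasurePreserving θ P P) {d : Ω → E}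
    (hd : StronglyMeasurable[G.comap θ] d) (hd0 : P[d | G] =ᵐ[P] 0)
    (hdp : MemLp d (ENNReal.ofReal p) P) :
    ∀ᵐ ω ∂P, Tendsto (fun n : ℕ => ENNReal.ofReal (((n : ℝ) + 1) ^ (-(1 / p)))
      * ‖∑ i ∈ Finset.range n, (d ∘ θ^[i]) ω‖ₑ) atTop (nhds 0) := by
  have hGle : G.comap θ ≤ mΩ := (MeasurableSpace.comap_mono hG).trans hθ.measurable.comap_le
  have hdm : StronglyMeasurable d := hd.mono hGle
  have hr1 : 1 ≤ ENNReal.ofReal p := by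
    rw [← ENNReal.ofReal_one]; exact ENNReal.ofReal_le_ofReal hp1.le
  have hK := maximalConst_nonneg hp1 hp2
  set T : (Ω → E) → ℕ → Ω → ℝ≥0∞ := fun f n ω => ENNReal.ofReal (((n : ℝ) + 1) ^ (-(1 / p)))
      * ‖∑ i ∈ Finset.range n, (f ∘ θ^[i]) ω‖ₑ with hT
  have hTm : ∀ n, Measurable (T d n) := fun n =>
    (StronglyMeasurable.enorm (Finset.stronglyMeasurable_fun_sum _
      fun i _ => hdm.comp_measurable (hθ.measurable.iterate i))).const_mul _
  -- Truncation at a fixed level `M`: the bounded part contributes nothing to the limsup by the case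
  -- `p < q`, and the rest has `L^p` norm at most `ε`. The factor 2 is the cost of centring.
  have key : ∀ ε : ℝ, 0 < ε → ∫⁻ ω, limsup (fun n => T d n ω) atTop ∂P
      ≤ ENNReal.ofReal ((1 + maximalConst p) * (2 * ε)) := by
    intro ε hε
    obtain ⟨M, hM0, hM⟩ := hdp.eLpNorm_indicator_norm_ge_pos_le hdm hε
    have hsm : StronglyMeasurable[G.comap θ] (smallPart M d) := stronglyMeasurable_smallPart hd M
    have hlm : StronglyMeasurable[G.comap θ] (largePart M d) := stronglyMeasurable_largePart hd M
    have hsb : ∀ q : ℝ≥0∞, MemLp (smallPart M d) q P := fun q =>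
      MemLp.of_bound (hsm.mono hGle).aestronglyMeasurable M
        (ae_of_all _ fun ω => norm_smallPart_le hM0.le _ ω)
    have hle : eLpNorm (largePart M d) (ENNReal.ofReal p) P ≤ ENNReal.ofReal ε := by
      refine le_trans (eLpNorm_mono fun ω => ?_) hM
      rw [norm_largePart]
      split_ifs with h
      · rw [Set.indicator_of_mem]; exact h.le
      · exact norm_nonneg _
    have hlp : MemLp (largePart M d) (ENNReal.ofReal p) P :=
      ⟨(hlm.mono hGle).aestronglyMeasurable, hle.trans_lt ENNReal.ofReal_lt_top⟩
    have hcm : ∀ f : Ω → E, StronglyMeasurable[G.comap θ] (P[f | G]) := fun f =>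
      stronglyMeasurable_condExp.mono hGθ
    -- Any exponent strictly between `p` and 2 would serve.
    set q := (p + 2) / 2 with hq
    have hq1 : 1 ≤ ENNReal.ofReal q := by
      rw [← ENNReal.ofReal_one]; exact ENNReal.ofReal_le_ofReal (by rw [hq]; linarith)
    have hS := tendsto_martingale_of_lt (q := q) hp1 (by rw [hq]; linarith) (by rw [hq]; linarith)
      hG hGθ hθ (d := condCenter G P (smallPart M d)) (hsm.sub (hcm _))
      (condExp_condCenter hG (memLp_one_iff_integrable.1 (hsb 1)))
      ((hsb _).sub ((hsb _).condExp hq1))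
    have hB := lintegral_maximalFun_iterate_le hp1 hp2 hG hGθ hθ
      (d := condCenter G P (largePart M d)) (hlm.sub (hcm _))
      (condExp_condCenter hG (hlp.integrable hr1)) (hlp.sub (hlp.condExp hr1))
    have hsplit := ae_eq_condCenter_smallPart_add_largePart M (hdp.integrable hr1)
      (memLp_one_iff_integrable.1 (hsb 1)) hd0
    have hsplit' : ∀ᵐ ω ∂P, ∀ i : ℕ, (d ∘ θ^[i]) ω
        = (condCenter G P (smallPart M d) ∘ θ^[i]) ω
          + (condCenter G P (largePart M d) ∘ θ^[i]) ω :=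
      ae_all_iff.2 fun i => (hθ.iterate i).quasiMeasurePreserving.ae_eq_comp hsplit
    have hlim : ∀ᵐ ω ∂P, limsup (fun n => T d n ω) atTop
        ≤ maximalFun p (fun i => condCenter G P (largePart M d) ∘ θ^[i]) ω := by
      filter_upwards [hS, hsplit'] with ω h1 h2
      calc limsup (fun n => T d n ω) atTop
          ≤ limsup ((fun n => T (condCenter G P (smallPart M d)) n ω)
            + fun _ => maximalFun p (fun i => condCenter G P (largePart M d) ∘ θ^[i]) ω) atTop := by
            refine limsup_le_limsup (Eventually.of_forall fun n => ?_)
            simp only [hT, Pi.add_apply, h2, Finset.sum_add_distrib]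
            refine (mul_le_mul_right (enorm_add_le _ _) _).trans ?_
            rw [mul_add]
            gcongr
            exact term_le_maximalFun p (fun i => condCenter G P (largePart M d) ∘ θ^[i]) n ω
        _ = _ := by
            have h3 := Tendsto.add h1 (tendsto_const_nhds
              (x := maximalFun p (fun i => condCenter G P (largePart M d) ∘ θ^[i]) ω))
            rw [zero_add] at h3
            exact h3.limsup_eq
    refine (lintegral_mono_ae hlim).trans (hB.trans (ENNReal.ofReal_le_ofReal ?_))
    gcongr
    have h1 : lpNorm (condCenter G P (largePart M d)) (ENNReal.ofReal p) P
        ≤ lpNorm (largePart M d) (ENNReal.ofReal p) P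
          + lpNorm (P[largePart M d | G]) (ENNReal.ofReal p) P := lpNorm_sub_le hlp hr1
    have h2 := hlp.lpNorm_condExp_le_lpNorm (m := G) hr1
    have h3 : lpNorm (largePart M d) (ENNReal.ofReal p) P ≤ ε := by
      rw [← toReal_eLpNorm hlp.1]
      exact ENNReal.toReal_le_of_le_ofReal hε.le hle
    linarith
  have hzero : ∫⁻ ω, limsup (fun n => T d n ω) atTop ∂P = 0 := by
    have hc : Tendsto (fun ε : ℝ => ENNReal.ofReal ((1 + maximalConst p) * (2 * ε)))
        (nhdsWithin 0 (Set.Ioi 0)) (nhds (ENNReal.ofReal ((1 + maximalConst p) * (2 * 0)))) :=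
      ((ENNReal.continuous_ofReal.comp (continuous_const.mul
        (continuous_const.mul continuous_id))).tendsto 0).mono_left nhdsWithin_le_nhds
    have := ge_of_tendsto hc (eventually_nhdsWithin_of_forall key)
    simpa using this
  rw [lintegral_eq_zero_iff (Measurable.limsup hTm)] at hzero
  filter_upwards [hzero] with ω hω
  exact tendsto_of_le_liminf_of_limsup_le zero_le (le_of_eq hω)

end StationaryMartingale

end EmpiricalProcess

/-! ### Martingale decomposition and the law for stationary sequences -/

namespace EmpiricalProcess

/-- A positive limit would make the harmonic series converge. -/
theorem tendsto_zero_of_antitone_of_summable_div_sqrt {a : ℕ → ℝ} (ha0 : ∀ k, 0 ≤ a k)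
    (ha : Antitone a) (hs : Summable fun k : ℕ => a k / √(k + 1)) : Tendsto a atTop (nhds 0) := by
  have hbdd : BddBelow (Set.range a) := ⟨0, by rintro _ ⟨k, rfl⟩; exact ha0 k⟩
  have hlim := tendsto_atTop_ciInf ha hbdd
  have hl0 : 0 ≤ ⨅ k, a k := le_ciInf ha0
  rcases hl0.eq_or_lt with h | h
  · rwa [← h] at hlim
  exfalso
  have h1 : Summable fun k : ℕ => 1 / ((k + 1 : ℕ) : ℝ) := by
    refine Summable.of_nonneg_of_le (fun k => by positivity) (fun k => ?_)
      (hs.mul_left (⨅ k, a k)⁻¹)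
    have hk : (1 : ℝ) ≤ (k : ℝ) + 1 := by linarith [Nat.cast_nonneg (α := ℝ) k]
    have hsq : √((k : ℝ) + 1) ≤ (k : ℝ) + 1 := (Real.sqrt_le_left (by positivity)).2 (by nlinarith)
    have hle : ⨅ k, a k ≤ a k := ciInf_le hbdd k
    have hpos : 0 < √((k : ℝ) + 1) := Real.sqrt_pos.2 (by linarith)
    calc 1 / ((k + 1 : ℕ) : ℝ) ≤ 1 / √((k : ℝ) + 1) := by
          push_cast; exact one_div_le_one_div_of_le hpos hsq
      _ = (⨅ k, a k)⁻¹ * ((⨅ k, a k) / √((k : ℝ) + 1)) := by field_simp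
      _ ≤ _ := by gcongr
  exact Real.not_summable_one_div_natCast
    ((summable_nat_add_iff (f := fun k : ℕ => 1 / (k : ℝ)) 1).1 h1)

theorem lpNorm_congr_ae' {Ω E : Type*} {mΩ : MeasurableSpace Ω} {P : Measure Ω}
    [NormedAddCommGroup E] {p : ℝ≥0∞} {f g : Ω → E} (hf : AEStronglyMeasurable f P)
    (h : f =ᵐ[P] g) : lpNorm f p P = lpNorm g p P := by
  rw [← toReal_eLpNorm hf, ← toReal_eLpNorm (hf.congr h), eLpNorm_congr_ae h]

section StationarySequence

/-- The almost sure martingale decomposition of `Y`. -/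
theorem ae_hasSum_of_telescoping {Ω E : Type*} {mΩ : MeasurableSpace Ω} {P : Measure Ω}
    [NormedAddCommGroup E] [CompleteSpace E] {τ : Ω → Ω} (hτ : MeasurePreserving τ P P) {e d : ℕ → Ω → E}
    (hem : ∀ k, StronglyMeasurable (e k)) (he : ∀ k, Integrable (e k) P)
    (hde : ∀ k, d k =ᵐ[P] e k - e (k + 1) ∘ τ)
    (hd : ∑' k, ∫⁻ ω, ‖d k ω‖ₑ ∂P < ∞)
    (h0 : Tendsto (fun k => ∫⁻ ω, ‖e k ω‖ₑ ∂P) atTop (nhds 0)) :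
    ∀ᵐ ω ∂P, Summable (fun k => ‖d k (τ^[k] ω)‖) ∧ HasSum (fun k => d k (τ^[k] ω)) (e 0 ω) := by
  have hdm : ∀ k, AEStronglyMeasurable (d k) P := fun k =>
    ((he k).1.sub ((he (k + 1)).1.comp_measurePreserving hτ)).congr (hde k).symm
  have h1 : ∀ᵐ ω ∂P, ∀ k, d k (τ^[k] ω) = e k (τ^[k] ω) - e (k + 1) (τ^[k + 1] ω) := by
    refine ae_all_iff.2 fun k => ?_
    have := (hτ.iterate k).quasiMeasurePreserving.ae_eq_comp (hde k)
    filter_upwards [this] with ω hω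
    rw [Function.iterate_succ_apply']
    exact hω
  have hcomp : ∀ (f : Ω → E) (k : ℕ), AEStronglyMeasurable f P →
      ∫⁻ ω, ‖f (τ^[k] ω)‖ₑ ∂P = ∫⁻ ω, ‖f ω‖ₑ ∂P := by
    intro f k hf
    have := eLpNorm_comp_measurePreserving (p := 1) hf (hτ.iterate k)
    rwa [eLpNorm_one_eq_lintegral_enorm, eLpNorm_one_eq_lintegral_enorm] at this
  have h2 : ∀ᵐ ω ∂P, ∑' k, ‖d k (τ^[k] ω)‖ₑ < ∞ := by
    have hm : ∀ k, AEMeasurable (fun ω => ‖d k (τ^[k] ω)‖ₑ) P := fun k =>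
      ((hdm k).comp_measurePreserving (hτ.iterate k)).enorm
    refine ae_lt_top' (AEMeasurable.tsum hm) ?_
    rw [lintegral_tsum hm]
    simp_rw [hcomp _ _ (hdm _)]
    exact hd.ne
  -- The remainder `e_k ∘ τ^k` tends to zero in `L¹`, so by Fatou its liminf vanishes almost surely.
  -- Absolute convergence of the series gives it a genuine limit, which is then zero.
  have h3 : ∀ᵐ ω ∂P, liminf (fun k => ‖e k (τ^[k] ω)‖ₑ) atTop = 0 := by
    have hm : ∀ k, Measurable fun ω => ‖e k (τ^[k] ω)‖ₑ := fun k =>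
      ((hem k).comp_measurable (hτ.measurable.iterate k)).enorm
    have hl := lintegral_liminf_le (μ := P) (u := atTop) hm
    simp_rw [hcomp _ _ (he _).1] at hl
    rw [h0.liminf_eq, nonpos_iff_eq_zero, lintegral_eq_zero_iff (Measurable.liminf hm)] at hl
    exact hl
  filter_upwards [h1, h2, h3] with ω h1 h2 h3
  have hsn : Summable (fun k => ‖d k (τ^[k] ω)‖) := by
    have := ENNReal.summable_toReal h2.ne
    simpa using this
  have hs : Summable (fun k => d k (τ^[k] ω)) := hsn.of_norm
  refine ⟨hsn, ?_⟩
  have hps := hs.hasSum.tendsto_sum_nat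
  set s := ∑' k, d k (τ^[k] ω) with hsdef
  have htel : ∀ K, ∑ k ∈ Finset.range K, d k (τ^[k] ω) = e 0 ω - e K (τ^[K] ω) := by
    intro K
    simp_rw [h1]
    rw [Finset.sum_range_sub' (fun k => e k (τ^[k] ω))]
    rfl
  have hlim : Tendsto (fun K => e K (τ^[K] ω)) atTop (nhds (e 0 ω - s)) := by
    have := (tendsto_const_nhds (x := e 0 ω)).sub hps
    simpa [htel] using this
  have h4 := hlim.enorm.liminf_eq
  rw [h3] at h4
  have h5 : e 0 ω = s := sub_eq_zero.1 (enorm_eq_zero.1 h4.symm)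
  rw [h5]
  exact hs.hasSum

variable {Ω E : Type*} {F G mΩ : MeasurableSpace Ω} {P : Measure Ω} [IsProbabilityMeasure P]
  [NormedAddCommGroup E] [InnerProductSpace ℝ E] [CompleteSpace E]

/-- Shifting the past: `E(E(Y ∘ θ^k | F) | θ F) = E(Y ∘ θ^{k+1} | F) ∘ θ⁻¹`. -/
theorem condExp_condExp_iterate {θ : Ω ≃ᵐ Ω} (hθ : MeasurePreserving θ P P) (hF : F ≤ mΩ)
    (hGF : F.comap θ.symm ≤ F) {Y : Ω → E} (hY : Integrable Y P) (k : ℕ) :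
    P[P[Y ∘ θ^[k] | F] | F.comap θ.symm] =ᵐ[P] P[Y ∘ θ^[k + 1] | F] ∘ θ.symm := by
  refine (condExp_condExp_of_le hGF hF).trans ?_
  have h := condExp_comp_measurePreserving (hθ.symm θ) hF
    ((hθ.iterate (k + 1)).integrable_comp_of_integrable hY)
  have e : (Y ∘ θ^[k + 1]) ∘ θ.symm = Y ∘ θ^[k] := by
    funext ω; simp
  rwa [e] at h

/-- `G` is the past one step earlier than `F`, so each `d k` below is an increment of the filtration
generated by `G` and `θ`. The sums of `Y` become a series over `k` of martingales evaluated at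
`τ^[k] ω`, each negligible, with summable maximal functions. -/
theorem tendsto_stationary_sum_of_past {p : ℝ} (hp1 : 1 < p) (hp2 : p < 2)
    {θ : Ω ≃ᵐ Ω} (hθ : MeasurePreserving θ P P) (hF : F ≤ mΩ) (hGd : G = F.comap θ.symm) (hGθF : G.comap θ = F) (hGF : G ≤ F)
    {Y : Ω → E} (hY : StronglyMeasurable[F] Y) (hYp : MemLp Y (ENNReal.ofReal p) P)
    (hs : Summable fun k : ℕ => lpNorm (P[Y ∘ θ^[k] | F]) (ENNReal.ofReal p) P / √(k + 1)) :
    ∀ᵐ ω ∂P, Tendsto (fun n : ℕ => ((n : ℝ) + 1) ^ (-(1 / p))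
      • ∑ i ∈ Finset.range n, Y (θ^[i] ω)) atTop (nhds 0) := by
  set r := ENNReal.ofReal p with hr
  have hr1 : 1 ≤ r := by
    rw [hr, ← ENNReal.ofReal_one]; exact ENNReal.ofReal_le_ofReal hp1.le
  have hK := maximalConst_nonneg hp1 hp2
  have hYi : Integrable Y P := hYp.integrable hr1
  set τ : Ω → Ω := ⇑θ.symm with hτd
  have hτ : MeasurePreserving τ P P := hθ.symm θ
  have hG : G ≤ mΩ := hGF.trans hF
  have hGθ : G ≤ G.comap θ := by rw [hGθF]; exact hGF
  set e : ℕ → Ω → E := fun k => P[Y ∘ θ^[k] | F] with he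
  have hYk : ∀ k, MemLp (Y ∘ θ^[k]) r P := fun k => hYp.comp_measurePreserving (hθ.iterate k)
  have hek : ∀ k, MemLp (e k) r P := fun k => (hYk k).condExp hr1
  have hei : ∀ k, Integrable (e k) P := fun k => integrable_condExp
  have hshift : ∀ k, P[e k | G] =ᵐ[P] e (k + 1) ∘ τ := fun k =>
    by subst hGd; exact condExp_condExp_iterate hθ hF hGF hYi k
  set d : ℕ → Ω → E := fun k => condCenter G P (e k) with hd
  have hdm : ∀ k, StronglyMeasurable[G.comap θ] (d k) := by
    intro k
    rw [hGθF]
    exact stronglyMeasurable_condExp.sub (stronglyMeasurable_condExp.mono hGF)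
  have hdmΩ : ∀ k, StronglyMeasurable (d k) := fun k =>
    (hdm k).mono (by rw [hGθF]; exact hF)
  have hd0 : ∀ k, P[d k | G] =ᵐ[P] 0 := fun k => condExp_condCenter hG (hei k)
  have hdp : ∀ k, MemLp (d k) r P := fun k => (hek k).sub ((hek k).condExp hr1)
  set a : ℕ → ℝ := fun k => lpNorm (e k) r P with ha
  set δ : ℕ → ℝ := fun k => lpNorm (d k) r P with hδ
  have hanext : ∀ k, lpNorm (P[e k | G]) r P = a (k + 1) := by
    intro k
    rw [lpNorm_congr_ae' integrable_condExp.1 (hshift k), ha,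
      ← toReal_eLpNorm ((hei (k + 1)).1.comp_measurePreserving hτ),
      eLpNorm_comp_measurePreserving (hei (k + 1)).1 hτ, toReal_eLpNorm (hei (k + 1)).1]
  have hanti : Antitone a := antitone_nat_of_succ_le fun k => by
    rw [← hanext k]; exact (hek k).lpNorm_condExp_le_lpNorm hr1
  -- By the shift identity, conditioning `e k` on `G` lowers its norm from `a k` to exactly `a (k +
  -- 1)`, so the loss is a telescoping difference.
  have hsq : ∀ k, δ k ^ 2 ≤ 8 / (p - 1) * (a k * (a k - a (k + 1))) := by
    intro k
    rw [← hanext k]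
    exact sq_lpNorm_sub_condExp_le hp1 hp2 hG (hek k) EventuallyEq.rfl
  have hδs : Summable δ := summable_of_sq_le_mul_sub (div_nonneg (by norm_num) (by linarith))
    (fun k => lpNorm_nonneg) hanti (fun k => lpNorm_nonneg) hsq hs
  have ha0 : Tendsto a atTop (nhds 0) :=
    tendsto_zero_of_antitone_of_summable_div_sqrt (fun k => lpNorm_nonneg) hanti hs
  have hL1 : ∀ f : Ω → E, MemLp f r P → ∫⁻ ω, ‖f ω‖ₑ ∂P ≤ ENNReal.ofReal (lpNorm f r P) := by
    intro f hf
    rw [ofReal_lpNorm hf, ← eLpNorm_one_eq_lintegral_enorm]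
    exact eLpNorm_le_eLpNorm_of_exponent_le hr1 hf.1
  have hsum := ae_hasSum_of_telescoping hτ (fun k => stronglyMeasurable_condExp.mono hF) hei
    (fun k => EventuallyEq.rfl.sub (hshift k) : ∀ k, d k =ᵐ[P] e k - e (k + 1) ∘ τ)
    ((ENNReal.tsum_le_tsum fun k => hL1 _ (hdp k)).trans_lt hδs.tsum_ofReal_lt_top)
    (tendsto_of_tendsto_of_tendsto_of_le_of_le tendsto_const_nhds
      (by simpa using ENNReal.tendsto_ofReal ha0) (fun k => zero_le) fun k => hL1 _ (hek k))
  have he0 : e 0 = Y := condExp_of_stronglyMeasurable hF hY hYi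
  have hsum' : ∀ᵐ ω ∂P, ∀ i : ℕ, HasSum (fun k => d k (τ^[k] (θ^[i] ω))) (Y (θ^[i] ω)) := by
    refine ae_all_iff.2 fun i => ?_
    filter_upwards [(hθ.iterate i).quasiMeasurePreserving.ae hsum] with ω hω
    rw [← he0]; exact hω.2
  set Z : ℕ → Ω → ℝ≥0∞ := fun k => maximalFun p (fun i => d k ∘ θ^[i]) with hZ
  have hZm : ∀ k, Measurable (Z k) := fun k =>
    measurable_maximalFun_iterate hθ.measurable (hdmΩ k) p
  -- Since `τ` preserves `P`, the shift by `τ^[k]` does not change the mean of `Z k`, which is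
  -- linear in `δ k`; summability of `δ` gives a finite total.
  have hZfin : ∀ᵐ ω ∂P, ∑' k, Z k (τ^[k] ω) < ∞ := by
    have hm : ∀ k, Measurable fun ω => Z k (τ^[k] ω) := fun k =>
      (hZm k).comp (hτ.measurable.iterate k)
    refine ae_lt_top (Measurable.tsum hm) ?_
    rw [lintegral_tsum fun k => (hm k).aemeasurable]
    have : ∀ k, ∫⁻ ω, Z k (τ^[k] ω) ∂P ≤ ENNReal.ofReal ((1 + maximalConst p) * δ k) := by
      intro k
      rw [(hτ.iterate k).lintegral_comp (hZm k)]
      exact lintegral_maximalFun_iterate_le hp1 hp2 hG hGθ hθ (hdm k) (hd0 k) (hdp k)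
    exact ((ENNReal.tsum_le_tsum this).trans_lt (hδs.mul_left _).tsum_ofReal_lt_top).ne
  have hlim : ∀ᵐ ω ∂P, ∀ k, Tendsto (fun n : ℕ => ENNReal.ofReal (((n : ℝ) + 1) ^ (-(1 / p)))
      * ‖∑ i ∈ Finset.range n, (d k ∘ θ^[i]) (τ^[k] ω)‖ₑ) atTop (nhds 0) :=
    ae_all_iff.2 fun k => (hτ.iterate k).quasiMeasurePreserving.ae
      (tendsto_martingale hp1 hp2 hG hGθ hθ (hdm k) (hd0 k) (hdp k))
  have hcomm : ∀ (i k : ℕ) (ω : Ω), τ^[k] (θ^[i] ω) = θ^[i] (τ^[k] ω) := by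
    intro i k ω
    have : Function.Commute τ θ := fun ω => by simp [hτd]
    exact (this.iterate_iterate k i) ω
  filter_upwards [hsum', hZfin, hlim] with ω hω hZω hlω
  have hterm : ∀ (n k : ℕ), ‖((n : ℝ) + 1) ^ (-(1 / p))
      • ∑ i ∈ Finset.range n, d k (θ^[i] (τ^[k] ω))‖
      = (ENNReal.ofReal (((n : ℝ) + 1) ^ (-(1 / p)))
      * ‖∑ i ∈ Finset.range n, (d k ∘ θ^[i]) (τ^[k] ω)‖ₑ).toReal := by
    intro n k
    rw [norm_smul, ENNReal.toReal_mul, ENNReal.toReal_ofReal (by positivity),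
      Real.norm_of_nonneg (by positivity), toReal_enorm]
    rfl
  have heq : ∀ n : ℕ, ((n : ℝ) + 1) ^ (-(1 / p)) • ∑ i ∈ Finset.range n, Y (θ^[i] ω)
      = ∑' k, ((n : ℝ) + 1) ^ (-(1 / p)) • ∑ i ∈ Finset.range n, d k (θ^[i] (τ^[k] ω)) := by
    intro n
    have h := (hasSum_sum fun i (_ : i ∈ Finset.range n) => hω i).const_smul
      (((n : ℝ) + 1) ^ (-(1 / p)))
    simp_rw [hcomm] at h
    exact h.tsum_eq.symm
  simp_rw [heq]
  have hfin : ∀ k, Z k (τ^[k] ω) ≠ ∞ := fun k => ENNReal.ne_top_of_tsum_ne_top hZω.ne k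
  -- Dominated convergence in `k` for fixed `ω`, with the maximal functions as the bound uniform in
  -- `n`.
  have := tendsto_tsum_of_dominated_convergence (𝓕 := atTop)
    (f := fun (n k : ℕ) => ((n : ℝ) + 1) ^ (-(1 / p))
      • ∑ i ∈ Finset.range n, d k (θ^[i] (τ^[k] ω))) (g := fun _ => (0 : E))
    (bound := fun k => (Z k (τ^[k] ω)).toReal) (ENNReal.summable_toReal hZω.ne)
    (fun k => by
      rw [tendsto_zero_iff_norm_tendsto_zero]
      simp_rw [hterm]
      exact (ENNReal.tendsto_toReal (a := 0) (by simp)).comp (hlω k))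
    (Eventually.of_forall fun n k => by
      rw [hterm]
      exact ENNReal.toReal_mono (hfin k)
        (term_le_maximalFun p (fun i => d k ∘ θ^[i]) n (τ^[k] ω)))
  simpa using this

/-- A Marcinkiewicz-Zygmund strong law for stationary Hilbert space valued sequences under a
projective condition in `L^p`, `1 < p < 2`. -/
theorem tendsto_stationary_sum {p : ℝ} (hp1 : 1 < p) (hp2 : p < 2)
    {θ : Ω ≃ᵐ Ω} (hθ : MeasurePreserving θ P P) (hF : F ≤ mΩ) (hFθ : F ≤ F.comap θ)
    {Y : Ω → E} (hY : StronglyMeasurable[F] Y) (hYp : MemLp Y (ENNReal.ofReal p) P)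
    (hs : Summable fun k : ℕ => lpNorm (P[Y ∘ θ^[k] | F]) (ENNReal.ofReal p) P / √(k + 1)) :
    ∀ᵐ ω ∂P, Tendsto (fun n : ℕ => ((n : ℝ) + 1) ^ (-(1 / p))
      • ∑ i ∈ Finset.range n, Y (θ^[i] ω)) atTop (nhds 0) := by
  refine tendsto_stationary_sum_of_past hp1 hp2 hθ hF rfl ?_ ?_ hY hYp hs
  · rw [MeasurableSpace.comap_comp]
    have : ⇑θ.symm ∘ ⇑θ = id := by funext ω; simp
    rw [this, MeasurableSpace.comap_id]
  · have h := MeasurableSpace.comap_mono (g := ⇑θ.symm) hFθ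
    rw [MeasurableSpace.comap_comp] at h
    have : ⇑θ ∘ ⇑θ.symm = id := by funext ω; simp
    rwa [this, MeasurableSpace.comap_id] at h

end StationarySequence

end EmpiricalProcess

namespace EmpiricalProcess

/-! ### Centred indicators as elements of `L²(μ)` -/

/-- The centred indicator `t ↦ 1_{x ≤ t} - F(t)`. -/
noncomputable def centeredStep (F : ℝ → ℝ) (x t : ℝ) : ℝ :=
  Set.indicator (Set.Iic t) (fun _ => (1 : ℝ)) x - F t

open Classical in
/-- The centred indicator as an element of `L²(μ)`, when it is square integrable. -/
noncomputable def centeredStepLp (μ : Measure ℝ) (F : ℝ → ℝ) (x : ℝ) : Lp ℝ 2 μ :=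
  if h : MemLp (centeredStep F x) 2 μ then h.toLp else 0

theorem measurable_uncurry_centeredStep {F : ℝ → ℝ} (hF : Measurable F) :
    Measurable (Function.uncurry (centeredStep F)) := by
  have h : Measurable fun z : ℝ × ℝ => if z.1 ≤ z.2 then (1 : ℝ) else 0 :=
    Measurable.ite (measurableSet_le measurable_fst measurable_snd) measurable_const
      measurable_const
  have e : Function.uncurry (centeredStep F)
      = fun z : ℝ × ℝ => (if z.1 ≤ z.2 then (1 : ℝ) else 0) - F z.2 := by
    funext z; simp [Function.uncurry, centeredStep, Set.indicator]
  rw [e]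
  exact h.sub (hF.comp measurable_snd)

theorem measurable_centeredStep {F : ℝ → ℝ} (hF : Measurable F) (x : ℝ) :
    Measurable (centeredStep F x) :=
  (measurable_uncurry_centeredStep hF).comp measurable_prodMk_left

theorem measurable_eLpNorm_centeredStep_sub (μ : Measure ℝ) [SFinite μ] {F g : ℝ → ℝ}
    (hF : Measurable F) (hg : Measurable g) :
    Measurable fun x => eLpNorm (fun t => centeredStep F x t - g t) 2 μ := by
  have hm : Measurable (Function.uncurry fun x t : ℝ => ‖centeredStep F x t - g t‖ₑ ^ (2 : ℝ)) :=
    ((measurable_uncurry_centeredStep hF).sub (hg.comp measurable_snd)).enorm.pow_const 2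
  have h := (Measurable.lintegral_prod_right hm (ν := μ)).pow_const ((1 : ℝ) / 2)
  have e : ∀ x, eLpNorm (fun t => centeredStep F x t - g t) 2 μ
      = (∫⁻ t, ‖centeredStep F x t - g t‖ₑ ^ (2 : ℝ) ∂μ) ^ ((1 : ℝ) / 2) := by
    intro x
    rw [eLpNorm_eq_lintegral_rpow_enorm_toReal (by norm_num) (by norm_num)]
    simp
  simp_rw [e]
  exact h

theorem memLp_centeredStep_iff {μ : Measure ℝ} {F : ℝ → ℝ} (hF : Measurable F) (x : ℝ) :
    MemLp (centeredStep F x) 2 μ ↔ eLpNorm (fun t => centeredStep F x t - 0) 2 μ < ∞ := by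
  simp only [sub_zero]
  exact ⟨fun h => h.2, fun h => ⟨(measurable_centeredStep hF x).aestronglyMeasurable, h⟩⟩

theorem measurableSet_memLp_centeredStep (μ : Measure ℝ) [SFinite μ] {F : ℝ → ℝ}
    (hF : Measurable F) : MeasurableSet {x | MemLp (centeredStep F x) 2 μ} := by
  simp_rw [memLp_centeredStep_iff hF]
  exact measurable_eLpNorm_centeredStep_sub μ hF measurable_const measurableSet_Iio

/-- By second countability an open set is a countable union of balls. For maps into `L²(μ)` this
reduces measurability to that of distances to fixed vectors. -/
theorem measurable_of_ball {α H : Type*} [MeasurableSpace α] [PseudoMetricSpace H]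
    [SecondCountableTopology H] [MeasurableSpace H] [BorelSpace H] {f : α → H}
    (hf : ∀ v r, MeasurableSet (f ⁻¹' Metric.ball v r)) : Measurable f := by
  refine measurable_of_isOpen fun U hU => ?_
  choose ε hε hεU using fun x : U => Metric.isOpen_iff.1 hU x x.2
  obtain ⟨T, hT, hTU⟩ := TopologicalSpace.isOpen_iUnion_countable
    (fun x : U => Metric.ball (x : H) (ε x)) fun x => Metric.isOpen_ball
  have hUeq : U = ⋃ x ∈ T, Metric.ball (x : H) (ε x) := by
    rw [hTU]
    apply Set.Subset.antisymm
    · intro x hx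
      exact Set.mem_iUnion.2 ⟨⟨x, hx⟩, Metric.mem_ball_self (hε _)⟩
    · exact Set.iUnion_subset fun x => hεU x
  rw [hUeq, Set.preimage_iUnion₂]
  exact MeasurableSet.biUnion hT fun x _ => hf _ _

/-- `L²(μ)` is separable, and the distance to a fixed `v` is a Tonelli integral of a jointly
measurable function. Where the step is not square integrable the map takes the constant value zero.
-/
theorem stronglyMeasurable_centeredStepLp (μ : Measure ℝ) [SigmaFinite μ] {F : ℝ → ℝ}
    (hF : Measurable F) : StronglyMeasurable (centeredStepLp μ F) := by
  have : Fact ((2 : ℝ≥0∞) ≠ ∞) := ⟨by norm_num⟩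
  let _ : MeasurableSpace (Lp ℝ 2 μ) := borel _
  have : BorelSpace (Lp ℝ 2 μ) := ⟨rfl⟩
  refine Measurable.stronglyMeasurable (measurable_of_ball fun v r => ?_)
  set S := {x | MemLp (centeredStep F x) 2 μ} with hS
  have hSm : MeasurableSet S := measurableSet_memLp_centeredStep μ hF
  have hm := measurable_eLpNorm_centeredStep_sub μ hF (Lp.stronglyMeasurable v).measurable
  have e : centeredStepLp μ F ⁻¹' Metric.ball v r
      = (S ∩ {x | eLpNorm (fun t => centeredStep F x t - v t) 2 μ < ENNReal.ofReal r})
        ∪ (Sᶜ ∩ {_x | (0 : Lp ℝ 2 μ) ∈ Metric.ball v r}) := by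
    ext x
    by_cases hx : MemLp (centeredStep F x) 2 μ
    · have h1 : x ∈ S := hx
      have h2 : centeredStepLp μ F x = hx.toLp := dif_pos hx
      simp only [Set.mem_preimage, h2, Set.mem_union, Set.mem_inter_iff, h1, true_and,
        Set.mem_compl_iff, not_true_eq_false, false_and, or_false]
      rw [Metric.mem_ball, ← edist_lt_ofReal, Lp.edist_def]
      have : eLpNorm (⇑(hx.toLp) - ⇑v) 2 μ
          = eLpNorm (fun t => centeredStep F x t - v t) 2 μ :=
        eLpNorm_congr_ae (hx.coeFn_toLp.sub EventuallyEq.rfl)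
      rw [this]
      rfl
    · have h1 : x ∉ S := hx
      have h2 : centeredStepLp μ F x = 0 := dif_neg hx
      simp [h1, h2]
  rw [e]
  exact (hSm.inter (hm measurableSet_Iio)).union (hSm.compl.inter (MeasurableSet.const _))

theorem enorm_centeredStepLp_le {μ : Measure ℝ} {F : ℝ → ℝ} (x : ℝ) :
    ‖centeredStepLp μ F x‖ₑ ≤ eLpNorm (centeredStep F x) 2 μ := by
  rw [centeredStepLp]
  split_ifs with h
  · rw [Lp.enorm_def, eLpNorm_congr_ae h.coeFn_toLp]
  · simp

/-- Averaging centred indicators against a probability measure `κ`: the `L²(μ)` norm of the mean is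
bounded by the distance of distribution functions. -/
theorem enorm_integral_centeredStepLp_le (μ : Measure ℝ) [SigmaFinite μ] {F : ℝ → ℝ}
    (hF : Measurable F) (κ : Measure ℝ) [IsProbabilityMeasure κ]
    (hκ : ∀ᵐ x ∂κ, MemLp (centeredStep F x) 2 μ) :
    ‖∫ x, centeredStepLp μ F x ∂κ‖ₑ ≤ eLpNorm (fun t => cdf κ t - F t) 2 μ := by
  -- Without integrability the Bochner integral is zero and the bound is trivial.
  by_cases hint : Integrable (centeredStepLp μ F) κ
  swap
  · rw [integral_undef hint]; simp
  by_cases htop : eLpNorm (fun t => cdf κ t - F t) 2 μ = ∞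
  · rw [htop]; exact le_top
  have hum : Measurable fun t => cdf κ t - F t := (monotone_cdf κ).measurable.sub hF
  have hu : MemLp (fun t => cdf κ t - F t) 2 μ := ⟨hum.aestronglyMeasurable, lt_top_iff_ne_top.2 htop⟩
  set v := ∫ x, centeredStepLp μ F x ∂κ with hv
  have hvm : Measurable v := (Lp.stronglyMeasurable v).measurable
  have hprod : Integrable (Function.uncurry fun x t => centeredStep F x t * v t) (κ.prod μ) := by
    have hm : Measurable (Function.uncurry fun x t => centeredStep F x t * v t) :=
      (measurable_uncurry_centeredStep hF).mul (hvm.comp measurable_snd)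
    refine ⟨hm.aestronglyMeasurable, ?_⟩
    rw [HasFiniteIntegral, lintegral_prod _ hm.enorm.aemeasurable]
    have hle : ∀ᵐ x ∂κ, ∫⁻ t, ‖centeredStep F x t * v t‖ₑ ∂μ
        ≤ ‖centeredStepLp μ F x‖ₑ * ‖v‖ₑ := by
      filter_upwards [hκ] with x hx
      have h := eLpNorm_smul_le_mul_eLpNorm (p := 2) (q := 2) (r := 1) (μ := μ)
        (Lp.aestronglyMeasurable v) (measurable_centeredStep hF x).aestronglyMeasurable
      rw [eLpNorm_one_eq_lintegral_enorm] at h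
      have e : ‖centeredStepLp μ F x‖ₑ = eLpNorm (centeredStep F x) 2 μ := by
        rw [centeredStepLp, dif_pos hx, Lp.enorm_def, eLpNorm_congr_ae hx.coeFn_toLp]
      rw [e, Lp.enorm_def]
      exact h
    refine (lintegral_mono_ae hle).trans_lt ?_
    rw [lintegral_mul_const' _ _ (by simp)]
    exact ENNReal.mul_lt_top hint.2 (by simp)
  have hinner : ∀ᵐ x ∂κ, inner ℝ v (centeredStepLp μ F x) = ∫ t, centeredStep F x t * v t ∂μ := by
    filter_upwards [hκ] with x hx
    rw [centeredStepLp, dif_pos hx, L2.inner_def]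
    refine integral_congr_ae ?_
    filter_upwards [hx.coeFn_toLp] with t ht
    rw [ht]
    simp
  have hcdf : ∀ t, ∫ x, centeredStep F x t ∂κ = cdf κ t - F t := by
    intro t
    simp only [centeredStep]
    rw [integral_sub ((integrable_const (1 : ℝ)).indicator measurableSet_Iic)
      (integrable_const _), integral_indicator_const _ measurableSet_Iic, cdf_eq_real]
    simp
  -- The mean `v` is tested against itself: Fubini turns the mean of the steps into `cdf κ - F`, and
  -- Cauchy-Schwarz finishes.
  have key : inner ℝ v v = inner ℝ v (hu.toLp) := by
    calc inner ℝ v v = ∫ x, inner ℝ v (centeredStepLp μ F x) ∂κ := (integral_inner hint v).symm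
      _ = ∫ x, ∫ t, centeredStep F x t * v t ∂μ ∂κ := integral_congr_ae hinner
      _ = ∫ t, ∫ x, centeredStep F x t * v t ∂κ ∂μ := integral_integral_swap hprod
      _ = ∫ t, (cdf κ t - F t) * v t ∂μ := by simp_rw [integral_mul_const, hcdf]
      _ = inner ℝ v (hu.toLp) := by
          rw [L2.inner_def]
          refine integral_congr_ae ?_
          filter_upwards [hu.coeFn_toLp] with t ht
          rw [ht]
          simp
  have hnorm : ‖v‖ ≤ ‖hu.toLp‖ := by
    have h1 := real_inner_le_norm v hu.toLp
    rw [← key, real_inner_self_eq_norm_sq] at h1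
    rcases (norm_nonneg v).eq_or_lt with h0 | h0
    · rw [← h0]; exact norm_nonneg _
    · nlinarith
  calc ‖v‖ₑ ≤ ‖hu.toLp‖ₑ := enorm_le_iff_norm_le.2 hnorm
    _ = _ := by rw [Lp.enorm_def, eLpNorm_congr_ae hu.coeFn_toLp]

end EmpiricalProcess

/-! ### Norms of the centred indicators, and the link with τ -/

namespace EmpiricalProcess

section Moments

theorem abs_coe_ennreal (x : ℝ≥0∞) : (x : EReal).abs = x := by
  induction x with
  | top => rfl
  | coe x =>
    have : ((x : ℝ≥0∞) : EReal) = ((x : ℝ) : EReal) := rfl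
    rw [this, EReal.abs_def, abs_of_nonneg x.coe_nonneg, ENNReal.ofReal_coe_nnreal]

/-- The square of the step at 0 is `F²` on the negative half-line and `(1 - F)²` on `[0, ∞)`: the
integrands of the tail condition. -/
theorem memLp_centeredStep_zero {μ : Measure ℝ} {F : ℝ → ℝ} (hF : Measurable F)
    (hT : TailCondition μ F) : MemLp (centeredStep F 0) 2 μ := by
  refine ⟨(measurable_centeredStep hF 0).aestronglyMeasurable, ?_⟩
  rw [eLpNorm_lt_top_iff_lintegral_rpow_enorm_lt_top (by norm_num) (by norm_num)]
  refine lt_of_le_of_lt ?_ hT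
  rw [← lintegral_add_compl _ (measurableSet_Ici (a := (0 : ℝ))), add_comm]
  have he : ∀ t, ‖centeredStep F 0 t‖ₑ ^ (2 : ℝ≥0∞).toReal
      = ENNReal.ofReal (centeredStep F 0 t ^ 2) := by
    intro t
    rw [← ofReal_norm, ENNReal.toReal_ofNat, ENNReal.rpow_ofNat, ← ENNReal.ofReal_pow (norm_nonneg _)]
    simp
  refine add_le_add ?_ ?_
  · rw [Set.compl_Ici]
    calc ∫⁻ t in Set.Iio 0, ‖centeredStep F 0 t‖ₑ ^ (2 : ℝ≥0∞).toReal ∂μ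
        = ∫⁻ t in Set.Iio 0, ENNReal.ofReal (F t ^ 2) ∂μ := by
          refine setLIntegral_congr_fun measurableSet_Iio fun t ht => ?_
          have : ¬ (0 : ℝ) ≤ t := not_le.2 ht
          simp only [he]
          simp [centeredStep, this]
      _ ≤ _ := lintegral_mono_set Set.Iio_subset_Iic_self
  · refine le_of_eq (setLIntegral_congr_fun measurableSet_Ici fun t ht => ?_)
    have : (0 : ℝ) ≤ t := ht
    simp only [he]
    simp [centeredStep, this]

/-- Moving the jump from 0 to `x` changes the step by `∓1` on `[0, x)` or `[x, 0)`, and the root of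
the mass of that interval is its `L²(μ)` norm. -/
theorem eLpNorm_centeredStep_le {μ : Measure ℝ} {F : ℝ → ℝ} (hF : Measurable F) (x : ℝ) :
    eLpNorm (centeredStep F x) 2 μ
      ≤ eLpNorm (centeredStep F 0) 2 μ + (signedMass μ x).abs ^ (1 / 2 : ℝ) := by
  have hind : ∀ (s : Set ℝ) (c : ℝ), MeasurableSet s → ‖c‖ₑ = 1 →
      eLpNorm (s.indicator fun _ => c) 2 μ = μ s ^ (1 / 2 : ℝ) := by
    intro s c hs hc
    rw [eLpNorm_indicator_const hs (by norm_num) (by norm_num), hc]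
    simp
  have hadd : ∀ (s : Set ℝ) (c : ℝ), MeasurableSet s → ‖c‖ₑ = 1 →
      (centeredStep F x = centeredStep F 0 + s.indicator fun _ => c) →
      eLpNorm (centeredStep F x) 2 μ ≤ eLpNorm (centeredStep F 0) 2 μ + μ s ^ (1 / 2 : ℝ) := by
    intro s c hs hc he
    rw [← hind s c hs hc, he]
    exact eLpNorm_add_le (measurable_centeredStep hF 0).aestronglyMeasurable
      (measurable_const.indicator hs).aestronglyMeasurable (by norm_num)
  rw [signedMass]
  split_ifs with hx
  · rw [abs_coe_ennreal]
    refine hadd _ (-1) measurableSet_Ico (by simp) ?_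
    funext t
    simp only [centeredStep, Pi.add_apply, Set.indicator, Set.mem_Iic, Set.mem_Ico]
    by_cases h1 : x ≤ t
    · simp [h1, hx.trans h1, h1.not_gt]
    · by_cases h2 : 0 ≤ t
      · simp [h1, h2, not_le.1 h1]; ring
      · simp [h1, h2]
  · rw [EReal.abs_neg, abs_coe_ennreal]
    refine hadd _ 1 measurableSet_Ico (by simp) ?_
    push Not at hx
    funext t
    simp only [centeredStep, Pi.add_apply, Set.indicator, Set.mem_Iic, Set.mem_Ico]
    by_cases h1 : x ≤ t
    · by_cases h2 : 0 ≤ t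
      · simp [h1, h2, h2.not_gt]
      · simp [h1, h2, not_le.1 h2]; ring
    · have h2 : ¬ 0 ≤ t := fun h => h1 (hx.le.trans h)
      simp [h1, h2]

end Moments

theorem measurable_distFun {Ω : Type*} [MeasurableSpace Ω] {P : Measure Ω} (X : Ω → ℝ) :
    Measurable (distFun P X) :=
  (monotone_cdf (P.map X)).measurable

section Link

variable {Ω : Type*} {F₀ mΩ : MeasurableSpace Ω} {P : Measure Ω} [IsProbabilityMeasure P]

/-- The conditional expectation of the centred indicator process is dominated by the distance
between the conditional and the unconditional distribution functions. -/
theorem eLpNorm_condExp_centeredStepLp_le_tau (hF₀ : F₀ ≤ mΩ) (μ : Measure ℝ) [SigmaFinite μ]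
    {X : Ω → ℝ} (hX : Measurable X) (hmem : ∀ᵐ ω ∂P, MemLp (centeredStep (distFun P X) (X ω)) 2 μ)
    (hint : Integrable (fun ω => centeredStepLp μ (distFun P X) (X ω)) P) (q : ℝ≥0∞) :
    eLpNorm (P[fun ω => centeredStepLp μ (distFun P X) (X ω) | F₀]) q P
      ≤ tau F₀ P μ q X := by
  have hD : Measurable (distFun P X) := measurable_distFun X
  have hid : Measurable[mΩ, F₀] (id : Ω → Ω) := measurable_id'' hF₀
  -- Conditioning on the identity map into `(Ω, F₀)` is conditioning on `F₀`, so the conditional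
  -- expectation is an integral against `regCondDistrib`.
  have h := condExp_ae_eq_integral_condDistrib (mβ := F₀) (X := (id : Ω → Ω)) hid hX.aemeasurable
    (stronglyMeasurable_centeredStepLp μ hD) hint
  rw [MeasurableSpace.comap_id] at h
  set S := {x | MemLp (centeredStep (distFun P X) x) 2 μ} with hS
  have hSm : MeasurableSet S := measurableSet_memLp_centeredStep μ hD
  -- Disintegration: almost every conditional law gives mass zero to the exceptional set, because
  -- the law of `X` does.
  have hκ : ∀ᵐ ω ∂P, ∀ᵐ x ∂regCondDistrib F₀ P X ω, MemLp (centeredStep (distFun P X) x) 2 μ := by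
    have h1 := setLIntegral_preimage_condDistrib (mβ := F₀) (X := (id : Ω → Ω)) (μ := P) hid
      hX.aemeasurable hSm.compl (MeasurableSet.univ)
    have h2 : P (X ⁻¹' Sᶜ) = 0 := hmem
    rw [Set.preimage_univ, Set.univ_inter, h2, setLIntegral_univ, lintegral_eq_zero_iff] at h1
    · exact h1
    · exact ((Kernel.measurable_coe _ hSm.compl).comp hid)
  refine eLpNorm_mono_enorm_ae ?_
  filter_upwards [h, hκ] with ω h1 h2
  rw [h1, enorm_eq_self]
  have hprob : IsProbabilityMeasure (regCondDistrib F₀ P X ω) := by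
    rw [regCondDistrib]; infer_instance
  exact enorm_integral_centeredStepLp_le μ hD (regCondDistrib F₀ P X ω) h2

end Link

end EmpiricalProcess

/-! ### The statistic as a normalised sum in `L²(μ)` -/

namespace EmpiricalProcess

theorem memLp_centeredStepLp_comp {Ω : Type*} {mΩ : MeasurableSpace Ω} {P : Measure Ω}
    [IsProbabilityMeasure P] {μ : Measure ℝ} [SigmaFinite μ] {F : ℝ → ℝ} (hF : Measurable F)
    (hT : TailCondition μ F) {X : Ω → ℝ} (hX : Measurable X) {p : ℝ} (hp : 1 < p)
    (hM : ∫⁻ ω, (signedMass μ (X ω)).abs ^ (p / 2) ∂P < ∞) :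
    MemLp (fun ω => centeredStepLp μ F (X ω)) (ENNReal.ofReal p) P := by
  have hp0 : 0 < p := by linarith
  refine ⟨((stronglyMeasurable_centeredStepLp μ hF).comp_measurable hX).aestronglyMeasurable, ?_⟩
  rw [eLpNorm_lt_top_iff_lintegral_rpow_enorm_lt_top (by simpa using hp0) ENNReal.ofReal_ne_top,
    ENNReal.toReal_ofReal hp0.le]
  set c := eLpNorm (centeredStep F 0) 2 μ with hc
  have hcfin : c < ∞ := (memLp_centeredStep_zero hF hT).2
  have hle : ∀ ω, ‖centeredStepLp μ F (X ω)‖ₑ ^ p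
      ≤ 2 ^ (p - 1) * (c ^ p + (signedMass μ (X ω)).abs ^ (p / 2)) := by
    intro ω
    calc ‖centeredStepLp μ F (X ω)‖ₑ ^ p
        ≤ (c + (signedMass μ (X ω)).abs ^ (1 / 2 : ℝ)) ^ p := by
          gcongr
          exact (enorm_centeredStepLp_le _).trans (eLpNorm_centeredStep_le hF _)
      _ ≤ 2 ^ (p - 1) * (c ^ p + ((signedMass μ (X ω)).abs ^ (1 / 2 : ℝ)) ^ p) :=
          ENNReal.rpow_add_le_mul_rpow_add_rpow _ _ hp.le
      _ = _ := by rw [← ENNReal.rpow_mul, one_div_mul_eq_div]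
  refine (lintegral_mono hle).trans_lt ?_
  rw [lintegral_const_mul' _ _ (by
    exact ENNReal.rpow_ne_top_of_nonneg (by linarith) (by norm_num)),
    lintegral_add_left measurable_const, lintegral_const, measure_univ, mul_one]
  refine ENNReal.mul_lt_top (ENNReal.rpow_lt_top_of_nonneg (by linarith) (by norm_num)) ?_
  exact ENNReal.add_lt_top.2 ⟨ENNReal.rpow_lt_top_of_nonneg hp0.le hcfin.ne, hM⟩

/-- The statistic `D_n(μ)` as the norm of a sum in `L²(μ)`. -/
theorem cvmStat_eq_enorm_sum {Ω : Type*} [MeasurableSpace Ω] (P : Measure Ω) (μ : Measure ℝ)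
    (X : ℕ → Ω → ℝ) {n : ℕ} (hn : 1 ≤ n) {ω : Ω}
    (hmem : ∀ i, MemLp (centeredStep (distFun P (X 0)) (X i ω)) 2 μ) :
    cvmStat P μ X n ω
      = ‖(n : ℝ)⁻¹ • ∑ i ∈ Finset.Icc 1 n, centeredStepLp μ (distFun P (X 0)) (X i ω)‖ₑ := by
  set F := distFun P (X 0) with hF
  have hn0 : (n : ℝ) ≠ 0 := by positivity
  rw [cvmStat, Lp.enorm_def]
  refine eLpNorm_congr_ae ?_
  have h1 : ∀ᵐ t ∂μ, ∀ i, centeredStepLp μ F (X i ω) t = centeredStep F (X i ω) t := by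
    refine ae_all_iff.2 fun i => ?_
    rw [centeredStepLp, dif_pos (hmem i)]
    exact (hmem i).coeFn_toLp
  filter_upwards [h1, Lp.coeFn_smul (n : ℝ)⁻¹ (∑ i ∈ Finset.Icc 1 n, centeredStepLp μ F (X i ω)),
    Lp.coeFn_finsetSum (Finset.Icc 1 n) fun i => centeredStepLp μ F (X i ω)] with t h1 h2 h3
  rw [h2, Pi.smul_apply, h3, Finset.sum_apply]
  simp_rw [h1, centeredStep]
  rw [Finset.sum_sub_distrib, Finset.sum_const, Nat.card_Icc, Nat.add_sub_cancel, empDistFun,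
    smul_eq_mul, mul_sub, nsmul_eq_mul, ← mul_assoc, inv_mul_cancel₀ hn0, one_mul]

/-- Passes from the hypothesis in `[0, ∞]` with logarithmic weight to the real projective condition:
`log n ≥ log 2` for `n ≥ 2`, and the terms `k = 0, 1` do not affect summability. -/
theorem summable_lpNorm_div_sqrt {Ω E : Type*} [MeasurableSpace Ω] {P : Measure Ω}
    [NormedAddCommGroup E] {q : ℝ≥0∞} {e : ℕ → Ω → E} (he : ∀ k, MemLp (e k) q P) {t : ℕ → ℝ≥0∞}
    (het : ∀ k, eLpNorm (e k) q P ≤ t k)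
    (hsum : ∑' n : {n : ℕ // 2 ≤ n},
      ENNReal.ofReal (Real.log (n : ℕ) / ((n : ℕ) : ℝ) ^ (1 / 2 : ℝ)) * t n < ∞) :
    Summable fun k : ℕ => lpNorm (e k) q P / √(k + 1) := by
  rw [← summable_nat_add_iff 2]
  set g : ℕ → ℝ≥0∞ := fun k =>
    ENNReal.ofReal (Real.log ((k + 2 : ℕ) : ℝ) / ((k + 2 : ℕ) : ℝ) ^ (1 / 2 : ℝ)) * t (k + 2) with hg
  have hgfin : ∑' k, g k ≠ ∞ := by
    refine ne_top_of_le_ne_top hsum.ne ?_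
    exact ENNReal.tsum_comp_le_tsum_of_injective
      (f := fun k : ℕ => (⟨k + 2, by omega⟩ : {n : ℕ // 2 ≤ n}))
      (fun a b h => by simpa using h) (fun n : {n : ℕ // 2 ≤ n} =>
        ENNReal.ofReal (Real.log (n : ℕ) / ((n : ℕ) : ℝ) ^ (1 / 2 : ℝ)) * t n)
  have hlog2 : 0 < Real.log 2 := Real.log_pos (by norm_num)
  refine Summable.of_nonneg_of_le (fun k => div_nonneg lpNorm_nonneg (Real.sqrt_nonneg _))
    (fun k => ?_) ((ENNReal.summable_toReal hgfin).mul_left (Real.log 2)⁻¹)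
  have hk2 : (2 : ℝ) ≤ ((k + 2 : ℕ) : ℝ) := by push_cast; linarith [Nat.cast_nonneg (α := ℝ) k]
  have hpos : 0 < √((k + 2 : ℕ) : ℝ) := Real.sqrt_pos.2 (by linarith)
  have hle : ENNReal.ofReal (Real.log 2 * (lpNorm (e (k + 2)) q P / √((k + 2 : ℕ) + 1))) ≤ g k := by
    rw [hg]
    have h1 : ENNReal.ofReal (lpNorm (e (k + 2)) q P) ≤ t (k + 2) := by
      rw [ofReal_lpNorm (he _)]; exact het _
    refine le_trans ?_ (mul_le_mul_right h1 _)
    rw [← ENNReal.ofReal_mul (by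
      rw [← Real.sqrt_eq_rpow]
      exact div_nonneg (Real.log_nonneg (by linarith)) hpos.le)]
    refine ENNReal.ofReal_le_ofReal ?_
    rw [← Real.sqrt_eq_rpow, mul_div_assoc', div_mul_eq_mul_div]
    have : (0 : ℝ) ≤ lpNorm (e (k + 2)) q P := lpNorm_nonneg
    exact div_le_div₀ (mul_nonneg (Real.log_nonneg (by linarith)) this)
      (mul_le_mul_of_nonneg_right (Real.log_le_log two_pos hk2) this) hpos
      (Real.sqrt_le_sqrt (by linarith))
  have h2 := ENNReal.toReal_mono (ENNReal.ne_top_of_tsum_ne_top hgfin k) hle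
  rw [ENNReal.toReal_ofReal (mul_nonneg hlog2.le
    (div_nonneg lpNorm_nonneg (Real.sqrt_nonneg _)))] at h2
  rw [inv_mul_eq_div, le_div_iff₀ hlog2, mul_comm]
  exact h2

end EmpiricalProcess
-- Conclusion
theorem mainTheorem8 {Ω : Type*} (𝓕₀ : MeasurableSpace Ω) [mΩ : MeasurableSpace Ω]
    (P : Measure Ω) [IsProbabilityMeasure P]
    (θ : Ω ≃ᵐ Ω) (hθ : MeasurePreserving θ P P)
    (h𝓕₀ : 𝓕₀ ≤ mΩ) (h𝓕₀θ : 𝓕₀ ≤ 𝓕₀.comap θ)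
    (X₀ : Ω → ℝ) (hX₀ : Measurable[𝓕₀] X₀)
    (μ : Measure ℝ) [SigmaFinite μ]
    (p : ℝ) (hp1 : 1 < p) (hp2 : p < 2)
    (hF : EmpiricalProcess.TailCondition μ (EmpiricalProcess.distFun P X₀))
    (hFμ : ∫⁻ ω, (EmpiricalProcess.signedMass μ (X₀ ω)).abs ^ (p / 2) ∂P < ∞)
    (hτ : ∑' n : {n : ℕ // 2 ≤ n},
        ENNReal.ofReal (Real.log (n : ℕ) / ((n : ℕ) : ℝ) ^ (1 / 2 : ℝ)) *
          EmpiricalProcess.tau 𝓕₀ P μ (ENNReal.ofReal p)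
            (EmpiricalProcess.orbitSeq θ X₀ n) < ∞) :
    ∀ᵐ ω ∂P,
      (∀ n : ℕ, 1 ≤ n →
        EmpiricalProcess.cvmStat P μ (EmpiricalProcess.orbitSeq θ X₀) n ω < ∞) ∧
      (fun n : ℕ => (n : ℝ) *
        (EmpiricalProcess.cvmStat P μ (EmpiricalProcess.orbitSeq θ X₀) n ω).toReal)
        =o[atTop] (fun n : ℕ => (n : ℝ) ^ (1 / p)) := by
  open EmpiricalProcess in
  have hp0 : 0 < p := by linarith
  have hr1 : 1 ≤ ENNReal.ofReal p := by
    rw [← ENNReal.ofReal_one]; exact ENNReal.ofReal_le_ofReal hp1.le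
  have hX : Measurable X₀ := hX₀.mono h𝓕₀ le_rfl
  set F := distFun P X₀ with hFd
  have hFm : Measurable F := measurable_distFun X₀
  have hsm := stronglyMeasurable_centeredStepLp μ hFm
  set Y : Ω → Lp ℝ 2 μ := fun ω => centeredStepLp μ F (X₀ ω) with hY
  have hYp : MemLp Y (ENNReal.ofReal p) P := memLp_centeredStepLp_comp hFm hF hX hp1 hFμ
  -- almost surely all the centred indicators are square integrable
  have hmem0 : ∀ᵐ ω ∂P, MemLp (centeredStep F (X₀ ω)) 2 μ := by
    have hS := measurableSet_memLp_centeredStep μ hFm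
    have h1 : MeasurableSet {ω | MemLp (centeredStep F (X₀ ω)) 2 μ} := hX hS
    by_contra hcon
    rw [ae_iff] at hcon
    have hpos : 0 < P {ω | ¬ MemLp (centeredStep F (X₀ ω)) 2 μ} := pos_iff_ne_zero.2 hcon
    -- Failure of square integrability forces `|F_μ(X₀)| = ∞`, which the moment hypothesis excludes
    -- on a set of positive probability.
    have htop : ∀ ω ∈ {ω | ¬ MemLp (centeredStep F (X₀ ω)) 2 μ},
        (⊤ : ℝ≥0∞) ≤ (signedMass μ (X₀ ω)).abs ^ (p / 2) := by
      intro ω hω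
      by_contra hlt
      push Not at hlt
      refine hω ⟨(measurable_centeredStep hFm _).aestronglyMeasurable, ?_⟩
      refine (eLpNorm_centeredStep_le hFm _).trans_lt (ENNReal.add_lt_top.2
        ⟨(memLp_centeredStep_zero hFm hF).2, ENNReal.rpow_lt_top_of_nonneg (by norm_num) ?_⟩)
      intro hab
      rw [hab, ENNReal.top_rpow_of_pos (by positivity)] at hlt
      exact lt_irrefl _ hlt
    have h2 : ∫⁻ ω in {ω | ¬ MemLp (centeredStep F (X₀ ω)) 2 μ}, (⊤ : ℝ≥0∞) ∂P
        ≤ ∫⁻ ω, (signedMass μ (X₀ ω)).abs ^ (p / 2) ∂P :=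
      (setLIntegral_mono' h1.compl htop).trans (setLIntegral_le_lintegral _ _)
    rw [setLIntegral_const, ENNReal.top_mul hpos.ne'] at h2
    exact absurd (h2.trans_lt hFμ) (lt_irrefl _)
  have hmem : ∀ᵐ ω ∂P, ∀ i, MemLp (centeredStep F (orbitSeq θ X₀ i ω)) 2 μ :=
    ae_all_iff.2 fun i => (hθ.iterate i).quasiMeasurePreserving.ae hmem0
  have hdist : ∀ k, distFun P (orbitSeq θ X₀ k) = F := by
    intro k
    have : P.map (orbitSeq θ X₀ k) = P.map X₀ := by
      have e : orbitSeq θ X₀ k = X₀ ∘ θ^[k] := rfl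
      rw [e, ← Measure.map_map hX (hθ.iterate k).measurable, (hθ.iterate k).map_eq]
    funext t
    rw [hFd, distFun, distFun, this]
  have hYk : ∀ k, MemLp (Y ∘ θ^[k]) (ENNReal.ofReal p) P := fun k =>
    hYp.comp_measurePreserving (hθ.iterate k)
  have hsum : Summable fun k : ℕ =>
      lpNorm (P[Y ∘ θ^[k] | 𝓕₀]) (ENNReal.ofReal p) P / √(k + 1) := by
    refine summable_lpNorm_div_sqrt
      (t := fun k => tau 𝓕₀ P μ (ENNReal.ofReal p) (orbitSeq θ X₀ k))
      (fun k => (hYk k).condExp hr1) (fun k => ?_) hτ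
    have h := eLpNorm_condExp_centeredStepLp_le_tau h𝓕₀ μ (P := P) (X := orbitSeq θ X₀ k)
      (hX.comp (hθ.iterate k).measurable) (by
        rw [hdist]; filter_upwards [hmem] with ω hω using hω k)
      (by rw [hdist]; exact (hYk k).integrable hr1) (ENNReal.ofReal p)
    rw [hdist] at h
    exact h
  have hlaw := tendsto_stationary_sum hp1 hp2 hθ h𝓕₀ h𝓕₀θ
    (hsm.comp_measurable hX₀) hYp hsum
  -- The law is used at `θ ω` because the empirical sums start at `i = 1`.
  filter_upwards [hmem, hθ.quasiMeasurePreserving.ae hlaw] with ω hω hlim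
  have hstat : ∀ n : ℕ, 1 ≤ n → cvmStat P μ (orbitSeq θ X₀) n ω
      = ‖(n : ℝ)⁻¹ • ∑ i ∈ Finset.Icc 1 n, centeredStepLp μ F (orbitSeq θ X₀ i ω)‖ₑ :=
    fun n hn => cvmStat_eq_enorm_sum P μ (orbitSeq θ X₀) hn hω
  refine ⟨fun n hn => by rw [hstat n hn]; simp, ?_⟩
  have hS : ∀ n : ℕ, 1 ≤ n → (n : ℝ) * (cvmStat P μ (orbitSeq θ X₀) n ω).toReal
      = ‖∑ i ∈ Finset.range n, Y (θ^[i] (θ ω))‖ := by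
    intro n hn
    have hn0 : (n : ℝ) ≠ 0 := by positivity
    rw [hstat n hn, toReal_enorm, norm_smul, norm_inv, Real.norm_natCast, ← mul_assoc,
      mul_inv_cancel₀ hn0, one_mul, ← Finset.Ico_add_one_right_eq_Icc,
      Finset.sum_Ico_eq_sum_range, Nat.add_sub_cancel]
    refine congrArg norm (Finset.sum_congr rfl fun i _ => ?_)
    rw [add_comm 1 i]
    rfl
  have hlit : (fun n : ℕ => ‖∑ i ∈ Finset.range n, Y (θ^[i] (θ ω))‖)
      =o[atTop] fun n : ℕ => ((n : ℝ) + 1) ^ (1 / p) := by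
    refine (isLittleO_iff_tendsto' (Eventually.of_forall fun n hn => ?_)).2 ?_
    · have : 0 < ((n : ℝ) + 1) ^ (1 / p) := by positivity
      exact absurd hn this.ne'
    · refine (tendsto_zero_iff_norm_tendsto_zero.1 hlim).congr fun n => ?_
      rw [norm_smul, Real.norm_of_nonneg (by positivity), Real.rpow_neg (by positivity)]
      exact (div_eq_inv_mul _ _).symm
  -- For `n ≥ 1`, `n + 1 ≤ 2n` gives the constant `2^(1/p)`.
  have hbig : (fun n : ℕ => ((n : ℝ) + 1) ^ (1 / p)) =O[atTop] fun n : ℕ => (n : ℝ) ^ (1 / p) := by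
    refine IsBigO.of_bound (2 ^ (1 / p)) ?_
    filter_upwards [eventually_ge_atTop 1] with n hn
    have hn1 : (1 : ℝ) ≤ n := by exact_mod_cast hn
    rw [Real.norm_of_nonneg (by positivity), Real.norm_of_nonneg (by positivity),
      ← Real.mul_rpow (by norm_num) (by positivity)]
    gcongr
    linarith
  refine (hlit.trans_isBigO hbig).congr' ?_ EventuallyEq.rfl
  filter_upwards [eventually_ge_atTop 1] with n hn
  rw [hS n hn]
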